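/- Let $n\ge 2$, $\alpha>0$, $\beta\ge 0$. For $\gamma>0$ consider the Cauchy problem for the linearized compressible Navier–Stokes system in $\mathbb{R}^n$ $$\rho_t+\gamma\,\mathrm{div}\,v=0,\qquad v_t-\alpha\Delta v-\beta\nabla\mathrm{div}\,v+\gamma\nabla\rho=0\quad\text{in }(0,\infty)\times\mathbb{R}^n,\qquad \rho(0,\cdot)=\rho_0,\quad v(0,\cdot)=v_0,$$ with real-valued data $\rho_0\in L^2(\mathbb{R}^n)\cap L^{1,1}(\mathbb{R}^n)$ and $v_0=(v_{01},\dots,v_{0n})\in (L^2(\mathbb{R}^n)\cap L^{1,1}(\mathbb{R}^n))^n$, where $f\in L^{1,1}(\mathbb{R}^n)$ means $f \in L^1(\mathbb{R}^n)$ and $\|f\|_{1,1}:=\int_{\mathbb{R}^n}(1+|x|)|f(x)|\,dx<\infty$. Write $\|\cdot\|$ for the $L^2$-norm (with $\|f\|^2=\sum_j\|f_j\|^2$ for vector fields) and $$P_0:=\int_{\mathbb{R}^n}v_0(x)\,dx\in\mathbb{R}^n,\qquad Q_0:=\int_{\mathbb{R}^n}\rho_0(x)\,dx\in\mathbb{R}.$$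 A solution is a pair $(\rho,v)\in C([0,\infty);L^2(\mathbb{R}^n))\times C([0,\infty);L^2(\mathbb{R}^n)^n)$ that takes the initial data and satisfies the equations in the sense of tempered distributions in $x$ for every $t>0$ (that is, the pairings of $\rho(t)$ and $v_j(t)$ with each Schwartz function are differentiable in $t>0$, with the derivatives prescribed by the equations). There are constants $C_1>0$ and $K>0$ depending only on $n,\alpha,\beta$ and, for every $\gamma>0$, constants $C_2>0$ and $T_2>0$ depending only on $n,\alpha,\beta,\gamma$, such that for all such data and every solution $(\rho,v)$ the following holds. 1. For all $t\ge T_2$, $$\|v(t,\cdot)\|\le C_2\Big(|P_0|+|Q_0|+\sum_{j=1}^n\|v_{0j}\|_{1,1}+\|\rho_0\|_{1,1}+\|v_0\|+\|\rho_0\|\Big)t^{-n/4}.$$ 2. If $Q_0\neq 0$ and $|P_0|/|Q_0|<\frac{1}{1+K}$, then there is $T_1>0$ such that for all $t\ge T_1$ $$C_1\big(|P_0|+|Q_0|\big)t^{-n/4}\le\|v(t,\cdot)\|.$$ In particular, under the assumptions of part 2 the decay rate $t^{-n/4}$ is optimal. -/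

import Mathlib

open MeasureTheory

noncomputable section

namespace LinearizedNS

/-- `ℝⁿ` with its Euclidean norm. -/
abbrev E (n : ℕ) : Type := EuclideanSpace ℝ (Fin n)

/-- The partial derivative `∂φ/∂x_j`. -/
def pd {n : ℕ} (j : Fin n) (φ : E n → ℝ) (x : E n) : ℝ :=
  fderiv ℝ φ x (EuclideanSpace.single j 1)

/-- The Laplacian `∑ₖ ∂²φ/∂x_k²`. -/
def lap {n : ℕ} (φ : E n → ℝ) (x : E n) : ℝ :=
  ∑ k : Fin n, pd k (pd k φ) x

/-- Membership in the weighted space `L^{1,1}(ℝⁿ)`. -/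
def MemL11 {n : ℕ} (f : E n → ℝ) : Prop :=
  Integrable f ∧ Integrable (fun x => (1 + ‖x‖) * |f x|)

/-- The norm `‖f‖_{1,1} = ∫ (1 + |x|) |f(x)| dx`. -/
def norm11 {n : ℕ} (f : E n → ℝ) : ℝ :=
  ∫ x, (1 + ‖x‖) * |f x|

/-- The vector with the components `∫ f_j(x) dx`. -/
def moment {n : ℕ} (f : E n → E n) : E n :=
  WithLp.toLp 2 (fun j => ∫ x, f x j)

/-- `(ρ, v) ∈ C([0,∞); L²(ℝⁿ))^{1+n}` solves the Cauchy problem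
`ρ_t + γ div v = 0`, `v_t - α Δ v - β ∇ div v + γ ∇ ρ = 0`, `ρ(0) = ρ₀`, `v(0) = v₀`,
where the derivatives in `x` are taken in the sense of tempered distributions: every pairing with
a Schwartz function is differentiable in `t > 0`, and its derivative is given by the equations
with all derivatives in `x` moved to the test function. Values at `t < 0` are irrelevant. -/
structure IsSolution {n : ℕ} (α β γ : ℝ) (ρ₀ : Lp ℝ 2 (volume : Measure (E n)))
    (v₀ : Lp (E n) 2 (volume : Measure (E n)))
    (ρ : ℝ → Lp ℝ 2 (volume : Measure (E n)))
    (v : ℝ → Lp (E n) 2 (volume : Measure (E n))) : Prop where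
  continuousOn_density : ContinuousOn ρ (Set.Ici 0)
  continuousOn_velocity : ContinuousOn v (Set.Ici 0)
  initial_density : ρ 0 = ρ₀
  initial_velocity : v 0 = v₀
  mass : ∀ (φ : SchwartzMap (E n) ℝ) (t : ℝ), 0 < t →
    HasDerivAt (fun s => ∫ x, ρ s x * φ x)
      (∫ x, γ * ∑ k, v t x k * pd k φ x) t
  momentum : ∀ (j : Fin n) (φ : SchwartzMap (E n) ℝ) (t : ℝ), 0 < t →
    HasDerivAt (fun s => ∫ x, v s x j * φ x)
      (∫ x, (α * (v t x j * lap φ x) + β * ∑ k, v t x k * pd k (pd j φ) x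
        + γ * (ρ t x * pd j φ x))) t

end LinearizedNS

end

/-! ### The weak equations on the Fourier side -/

namespace LinearizedNS

open scoped FourierTransform SchwartzMap LineDeriv Real
open SchwartzMap

/-! The Fourier transform turns the system into one linear ordinary differential equation per
frequency `ξ`. The equations hold only after pairing with test functions, so a uniqueness argument
is needed: `ae_eq_zero_of_weak_ode` runs a Picard iteration in duality, and
`IsSolution.specState_eq_flow` concludes that the transform of every solution is almost everywhere
the exponential of the symbol applied to the transformed data. In Mathlib's normalization the
coefficients become `a = 4π²α`, `b = 4π²β`, `c = 2πγ`. What remains is the analysis of a single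
mode, combined with Plancherel.

Upper bound. Viscosity damps only the velocity. Adding to the energy a small multiple of `Im (conj
ρ̂ · (ξ · v̂))` passes the damping on to the density (`modified_energy_dissipation`), and
`exists_energy_decay` yields decay at rate `|ξ|² / (1 + |ξ|²)`. At low frequencies the `L¹` bound on
the data and a Gaussian integral give `t ^ (-n/2)` for the squared norm; at high frequencies the
decay is exponential and the `L²` norm of the data suffices.

Lower bound. The longitudinal part `ξ · v̂` is a damped oscillator with an explicit solution
(`IsMode.longitudinal_eq`). Near `ξ = 0` the initial velocity contributes an almost real number,
because `P₀` is real, while the initial density contributes `i` times an almost real multiple of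
`Q₀`. Taking imaginary parts therefore isolates `Q₀`, and the momentum cannot cancel it
(`IsMode.kinetic_ge`). On the annulus `t ^ (-1/2) ≤ |ξ| ≤ 2 t ^ (-1/2)` the damping factor stays
bounded below, the squared sine contributes a fixed fraction of the volume, and this volume is of
order `t ^ (-n/2)`. The speed `γ` enters only through the phase and through how large `t` must be,
so the constant does not depend on it. The condition on `|P₀| / |Q₀|` only serves to replace `|Q₀|`
by `|P₀| + |Q₀|`. -/

/-- The `L²` Fourier transform of a real-valued function. -/
noncomputable def spec {n : ℕ} (f : Lp ℝ 2 (volume : Measure (E n))) :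
    Lp ℂ 2 (volume : Measure (E n)) :=
  𝓕 (Complex.ofRealCLM.compLp f)

/-- The `j`-th component of a square integrable vector field. -/
noncomputable def component {n : ℕ} (j : Fin n) (v : Lp (E n) 2 (volume : Measure (E n))) :
    Lp ℝ 2 (volume : Measure (E n)) :=
  (EuclideanSpace.proj j : E n →L[ℝ] ℝ).compLp v

theorem coeFn_component {n : ℕ} (j : Fin n) (v : Lp (E n) 2 (volume : Measure (E n))) :
    component j v =ᵐ[volume] fun x => v x j :=
  (EuclideanSpace.proj j : E n →L[ℝ] ℝ).coeFn_compLp' v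

theorem integrable_mul_schwartz {n : ℕ} {𝕜 : Type*} [RCLike 𝕜]
    (f : Lp 𝕜 2 (volume : Measure (E n))) (φ : 𝓢(E n, 𝕜)) :
    Integrable (fun x => f x * φ x) :=
  (Lp.memLp f).integrable_mul (φ.memLp 2)

/-- The pairing of a real function with a complex Schwartz function. -/
noncomputable def pair {n : ℕ} (f : Lp ℝ 2 (volume : Measure (E n))) (φ : 𝓢(E n, ℂ)) : ℂ :=
  ∫ x, (f x : ℂ) * φ x

/-- The equations are stated for real test functions, but a Fourier transform is a complex one; this
splitting extends them to complex test functions. -/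
theorem pair_eq_re_add_im {n : ℕ} (f : Lp ℝ 2 (volume : Measure (E n))) (φ : 𝓢(E n, ℂ)) :
    pair f φ = ((∫ x, f x * postcompCLM Complex.reCLM φ x : ℝ) : ℂ)
      + ((∫ x, f x * postcompCLM Complex.imCLM φ x : ℝ) : ℂ) * Complex.I := by
  have h1 := integrable_mul_schwartz f (postcompCLM Complex.reCLM φ)
  have h2 := integrable_mul_schwartz f (postcompCLM Complex.imCLM φ)
  rw [← integral_complex_ofReal, ← integral_complex_ofReal, ← integral_mul_const,
    ← integral_add h1.ofReal (h2.ofReal.mul_const _), pair]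
  congr 1
  ext x
  simp only [postcompCLM_apply, Complex.reCLM_apply, Complex.imCLM_apply]
  push_cast
  conv_lhs => rw [← Complex.re_add_im (φ x)]
  ring

/-- Testing a solution against `𝓕 g` is testing its transform against `g`. This is how the equations
are carried to the Fourier side. -/
theorem pair_fourier {n : ℕ} (f : Lp ℝ 2 (volume : Measure (E n))) (g : 𝓢(E n, ℂ)) :
    pair f (𝓕 g) = ∫ ξ, spec f ξ * g ξ := by
  have h := congrArg (fun T => T g)
    (Lp.fourier_toTemperedDistribution_eq (Complex.ofRealCLM.compLp f))
  simp only [TemperedDistribution.fourier_apply, Lp.toTemperedDistribution_apply,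
    smul_eq_mul] at h
  rw [pair, spec]
  simp only [mul_comm _ (g _)]
  rw [← h]
  refine integral_congr_ae ?_
  filter_upwards [Complex.ofRealCLM.coeFn_compLp f] with x hx
  rw [hx, Complex.ofRealCLM_apply, mul_comm]

/-- The `j`-th standard basis vector. -/
noncomputable abbrev basisVec {n : ℕ} (j : Fin n) : E n := EuclideanSpace.single j 1

/-- The `j`-th partial derivative of a Schwartz function. -/
noncomputable abbrev partialDeriv {n : ℕ} {F : Type*} [NormedAddCommGroup F] [NormedSpace ℝ F]
    (j : Fin n) (φ : 𝓢(E n, F)) : 𝓢(E n, F) := ∂_{basisVec j} φ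

theorem pd_schwartz {n : ℕ} (j : Fin n) (φ : 𝓢(E n, ℝ)) :
    pd j φ = ⇑(partialDeriv j φ) := by
  ext x
  rfl

theorem lineDerivOp_postcompCLM {n : ℕ} (m : E n) (L : ℂ →L[ℝ] ℝ) (φ : 𝓢(E n, ℂ)) :
    ∂_{m} (postcompCLM L φ) = postcompCLM L (∂_{m} φ) := by
  ext x
  rw [lineDerivOp_apply_eq_fderiv, postcompCLM_apply, lineDerivOp_apply_eq_fderiv]
  have := (L.hasFDerivAt.comp x (φ.hasFDerivAt x)).fderiv
  have h2 : ⇑(postcompCLM L φ) = L ∘ φ := by ext; simp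
  rw [h2, this]
  rfl

variable {n : ℕ} {α β γ : ℝ} {ρ₀ : Lp ℝ 2 (volume : Measure (E n))}
  {v₀ : Lp (E n) 2 (volume : Measure (E n))} {ρ : ℝ → Lp ℝ 2 (volume : Measure (E n))}
  {v : ℝ → Lp (E n) 2 (volume : Measure (E n))}

theorem integral_component_mul (j : Fin n) (w : Lp (E n) 2 (volume : Measure (E n)))
    (φ : E n → ℝ) : ∫ x, w x j * φ x = ∫ x, component j w x * φ x := by
  refine integral_congr_ae ?_
  filter_upwards [coeFn_component j w] with x hx
  rw [hx]

theorem integrable_component_mul (j : Fin n) (w : Lp (E n) 2 (volume : Measure (E n)))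
    (φ : 𝓢(E n, ℝ)) : Integrable fun x => w x j * φ x := by
  refine (integrable_mul_schwartz (component j w) φ).congr ?_
  filter_upwards [coeFn_component j w] with x hx
  rw [hx]

theorem IsSolution.mass_schwartz (h : IsSolution α β γ ρ₀ v₀ ρ v) (φ : 𝓢(E n, ℝ)) {t : ℝ}
    (ht : 0 < t) :
    HasDerivAt (fun s => ∫ x, ρ s x * φ x)
      (γ * ∑ k, ∫ x, component k (v t) x * (partialDeriv k φ) x) t := by
  convert! h.mass φ t ht using 1
  simp only [pd_schwartz]
  rw [integral_const_mul, integral_finsetSum _ fun k _ => integrable_component_mul k _ _]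
  simp only [integral_component_mul]

theorem IsSolution.momentum_schwartz (h : IsSolution α β γ ρ₀ v₀ ρ v) (j : Fin n)
    (φ : 𝓢(E n, ℝ)) {t : ℝ} (ht : 0 < t) :
    HasDerivAt (fun s => ∫ x, component j (v s) x * φ x)
      (α * (∑ k, ∫ x, component j (v t) x * (partialDeriv k (partialDeriv k φ)) x)
        + β * (∑ k, ∫ x, component k (v t) x * (partialDeriv k (partialDeriv j φ)) x)
        + γ * ∫ x, ρ t x * (partialDeriv j φ) x) t := by
  have h0 := h.momentum j φ t ht
  simp only [lap, pd_schwartz] at h0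
  simp only [integral_component_mul j _ φ] at h0
  convert! h0 using 1
  have i1 : Integrable fun x => α * (v t x j *
      ∑ k, (partialDeriv k (partialDeriv k φ)) x) := by
    simp only [Finset.mul_sum]
    exact integrable_finsetSum _ fun k _ => (integrable_component_mul j _ _).const_mul _
  have i2 : Integrable fun x => β * ∑ k, v t x k *
      (partialDeriv k (partialDeriv j φ)) x :=
    (integrable_finsetSum _ fun k _ => integrable_component_mul k _ _).const_mul _
  have i3 : Integrable fun x => γ * (ρ t x * (partialDeriv j φ) x) :=
    (integrable_mul_schwartz _ _).const_mul _
  rw [integral_add (f := fun x => _ + _) (i1.add i2) i3, integral_add i1 i2]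
  have e1 : ∫ x, v t x j * ∑ k, partialDeriv k (partialDeriv k φ) x
      = ∑ k, ∫ x, v t x j * partialDeriv k (partialDeriv k φ) x := by
    simp only [Finset.mul_sum]
    exact integral_finsetSum _ fun k _ => integrable_component_mul j _ _
  rw [integral_const_mul, integral_const_mul, integral_const_mul, e1,
    integral_finsetSum _ fun k _ => integrable_component_mul k _ _]
  simp only [integral_component_mul]

theorem IsSolution.mass_pair (h : IsSolution α β γ ρ₀ v₀ ρ v) (φ : 𝓢(E n, ℂ)) {t : ℝ}
    (ht : 0 < t) :
    HasDerivAt (fun s => pair (ρ s) φ)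
      (γ * ∑ k, pair (component k (v t)) (partialDeriv k φ)) t := by
  have h1 := (h.mass_schwartz (postcompCLM Complex.reCLM φ) ht).ofReal_comp
  have h2 := (h.mass_schwartz (postcompCLM Complex.imCLM φ) ht).ofReal_comp
  simp only [pair_eq_re_add_im, ← lineDerivOp_postcompCLM]
  convert! h1.add (h2.mul_const Complex.I) using 1
  push_cast
  rw [Finset.sum_add_distrib, ← Finset.sum_mul]
  ring

theorem IsSolution.momentum_pair (h : IsSolution α β γ ρ₀ v₀ ρ v) (j : Fin n)
    (φ : 𝓢(E n, ℂ)) {t : ℝ} (ht : 0 < t) :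
    HasDerivAt (fun s => pair (component j (v s)) φ)
      (α * ∑ k, pair (component j (v t)) (partialDeriv k (partialDeriv k φ))
        + β * ∑ k, pair (component k (v t)) (partialDeriv k (partialDeriv j φ))
        + γ * pair (ρ t) (partialDeriv j φ)) t := by
  have h1 := (h.momentum_schwartz j (postcompCLM Complex.reCLM φ) ht).ofReal_comp
  have h2 := (h.momentum_schwartz j (postcompCLM Complex.imCLM φ) ht).ofReal_comp
  simp only [pair_eq_re_add_im, ← lineDerivOp_postcompCLM]
  convert! h1.add (h2.mul_const Complex.I) using 1
  push_cast
  rw [Finset.sum_add_distrib, Finset.sum_add_distrib, ← Finset.sum_mul, ← Finset.sum_mul]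
  ring

/-- Multiplication by `-2πi` times the `k`-th coordinate on Schwartz functions. -/
noncomputable def coordMul (k : Fin n) (g : 𝓢(E n, ℂ)) : 𝓢(E n, ℂ) :=
  -(2 * π * Complex.I) • smulLeftCLM ℂ (inner ℝ · (basisVec k)) g

theorem coordMul_apply (k : Fin n) (g : 𝓢(E n, ℂ)) (ξ : E n) :
    coordMul k g ξ = -(2 * π * Complex.I) * (ξ k * g ξ) := by
  have : (fun x : E n => inner ℝ x (basisVec k)).HasTemperateGrowth := by fun_prop
  simp only [coordMul, _root_.smul_apply, smulLeftCLM_apply_apply this, smul_eq_mul]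
  simp [EuclideanSpace.inner_single_right]

theorem lineDerivOp_fourier (k : Fin n) (g : 𝓢(E n, ℂ)) :
    partialDeriv k (𝓕 g) = 𝓕 (coordMul k g) :=
  lineDerivOp_fourier_eq g _

/-- The entries of the Fourier symbol of the system; `none` is the index of the density. -/
noncomputable def symbol (a b c : ℝ) (ξ : E n) : Matrix (Option (Fin n)) (Option (Fin n)) ℂ
  | none, none => 0
  | none, some k => -(Complex.I * c * ξ k)
  | some j, none => -(Complex.I * c * ξ j)
  | some j, some k => -((if j = k then a * ‖ξ‖ ^ 2 else 0 : ℝ) + b * (ξ j * ξ k) : ℂ)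

/-- The Fourier transforms of the density and of the velocity components. -/
noncomputable def specState (ρ : Lp ℝ 2 (volume : Measure (E n)))
    (v : Lp (E n) 2 (volume : Measure (E n))) : Option (Fin n) → Lp ℂ 2 (volume : Measure (E n))
  | none => spec ρ
  | some j => spec (component j v)

/-- On the Fourier side a solution solves a linear system of ordinary differential equations,
tested against Schwartz functions. -/
theorem IsSolution.hasDerivAt_specState (h : IsSolution α β γ ρ₀ v₀ ρ v) (g : 𝓢(E n, ℂ))
    (i : Option (Fin n)) {t : ℝ} (ht : 0 < t) :
    HasDerivAt (fun s => ∫ ξ, specState (ρ s) (v s) i ξ * g ξ)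
      (∑ l, ∫ ξ, specState (ρ t) (v t) l ξ *
        (symbol (4 * π ^ 2 * α) (4 * π ^ 2 * β) (2 * π * γ) ξ i l * g ξ)) t := by
  cases i with
  | none =>
    have h1 := h.mass_pair (𝓕 g) ht
    simp only [lineDerivOp_fourier, pair_fourier] at h1
    convert! h1 using 1
    rw [Fintype.sum_option, Finset.mul_sum]
    simp only [symbol, zero_mul, mul_zero, integral_zero, zero_add, specState]
    refine Finset.sum_congr rfl fun k _ => ?_
    rw [← integral_const_mul]
    congr 1
    ext ξ
    rw [coordMul_apply]
    push_cast
    ring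
  | some j =>
    have h1 := h.momentum_pair j (𝓕 g) ht
    simp only [lineDerivOp_fourier, pair_fourier] at h1
    convert! h1 using 1
    rw [Fintype.sum_option, add_comm]
    simp only [symbol, specState]
    congr 1
    · have e1 : ∀ k, ∫ ξ, spec (component k (v t)) ξ * coordMul k (coordMul j g) ξ
          = ∫ ξ, spec (component k (v t)) ξ * (-(4 * π ^ 2) * (ξ j * ξ k) * g ξ) := by
        intro k
        congr 1
        ext ξ
        simp only [coordMul_apply]
        linear_combination (spec (component k (v t)) ξ * (4 * π ^ 2 * (ξ j * ξ k) * g ξ)) *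
          Complex.I_sq
      have i1 : ∀ k, Integrable fun ξ => spec (component k (v t)) ξ *
          (-(4 * π ^ 2) * (ξ j * ξ k) * g ξ : ℂ) := by
        intro k
        refine (integrable_mul_schwartz (spec (component k (v t))) (coordMul k (coordMul j g))).congr
          (.of_forall fun ξ => ?_)
        simp only [coordMul_apply]
        linear_combination (spec (component k (v t)) ξ * (4 * π ^ 2 * (ξ j * ξ k) * g ξ)) *
          Complex.I_sq
      have i2 : ∀ k, Integrable fun ξ => spec (component j (v t)) ξ *
          coordMul k (coordMul k g) ξ := fun k => integrable_mul_schwartz _ _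
      have e2 : ∑ k, ∫ ξ, spec (component j (v t)) ξ * coordMul k (coordMul k g) ξ
          = ∫ ξ, spec (component j (v t)) ξ * (-(4 * π ^ 2) * ‖ξ‖ ^ 2 * g ξ) := by
        rw [← integral_finsetSum _ fun k _ => i2 k]
        congr 1
        ext ξ
        simp only [coordMul_apply]
        have : ((‖ξ‖ ^ 2 : ℝ) : ℂ) = ∑ k, (ξ k : ℂ) ^ 2 := by
          rw [EuclideanSpace.real_norm_sq_eq]; push_cast; rfl
        push_cast at this
        rw [this, Finset.mul_sum, Finset.sum_mul, Finset.mul_sum]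
        refine Finset.sum_congr rfl fun k _ => ?_
        linear_combination (spec (component j (v t)) ξ * (4 * π ^ 2 * (ξ k * ξ k) * g ξ)) *
          Complex.I_sq
      have i3 : Integrable fun ξ => spec (component j (v t)) ξ *
          (-(4 * π ^ 2) * ‖ξ‖ ^ 2 * g ξ : ℂ) := by
        refine (integrable_finsetSum Finset.univ fun k _ => i2 k).congr (.of_forall fun ξ => ?_)
        simp only [coordMul_apply]
        have : ((‖ξ‖ ^ 2 : ℝ) : ℂ) = ∑ k, (ξ k : ℂ) ^ 2 := by
          rw [EuclideanSpace.real_norm_sq_eq]; push_cast; rfl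
        push_cast at this
        rw [this, Finset.mul_sum, Finset.sum_mul, Finset.mul_sum]
        refine Finset.sum_congr rfl fun k _ => ?_
        linear_combination (spec (component j (v t)) ξ * (4 * π ^ 2 * (ξ k * ξ k) * g ξ)) *
          Complex.I_sq
      rw [e2]
      simp only [e1]
      have e3 : ∀ k, ∫ ξ, spec (component k (v t)) ξ *
          (-(((if j = k then 4 * π ^ 2 * α * ‖ξ‖ ^ 2 else 0 : ℝ) : ℂ) +
            ((4 * π ^ 2 * β : ℝ) : ℂ) * (ξ j * ξ k)) * g ξ) =
          (if j = k then (α : ℂ) * ∫ ξ, spec (component j (v t)) ξ *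
            (-(4 * π ^ 2) * ‖ξ‖ ^ 2 * g ξ) else 0) +
          β * ∫ ξ, spec (component k (v t)) ξ * (-(4 * π ^ 2) * (ξ j * ξ k) * g ξ) := by
        intro k
        rw [← integral_const_mul, ← integral_const_mul]
        split_ifs with hk
        · subst hk
          rw [← integral_add (i3.const_mul _) ((i1 j).const_mul _)]
          congr 1
          ext ξ
          push_cast
          ring
        · rw [zero_add]
          congr 1
          ext ξ
          push_cast
          ring
      simp only [e3]
      rw [Finset.sum_add_distrib, Finset.sum_ite_eq, ← Finset.mul_sum]
      simp
    · rw [← integral_const_mul]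
      congr 1
      ext ξ
      rw [coordMul_apply]
      push_cast
      ring

end LinearizedNS

/-! ### Uniqueness for weakly formulated parametric differential equations -/

namespace LinearizedNS

open scoped ContDiff Topology
open Filter Set

/-- A function vanishing at `0` is dominated by a function whose derivative dominates its
derivative. -/
theorem norm_le_of_norm_deriv_le {F : Type*} [NormedAddCommGroup F] [NormedSpace ℝ F]
    {f f' : ℝ → F} {B B' : ℝ → ℝ} {T : ℝ}
    (hf : ContinuousOn f (Ici 0)) (h0 : f 0 = 0) (hB0 : 0 ≤ B 0)
    (hd : ∀ s, 0 < s → HasDerivAt f (f' s) s) (hB : ∀ s, HasDerivAt B (B' s) s)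
    (hle : ∀ s ∈ Icc 0 T, ‖f' s‖ ≤ B' s) {s : ℝ} (hs : s ∈ Icc 0 T) : ‖f s‖ ≤ B s := by
  rcases hs.1.eq_or_lt with rfl | hs0
  · simpa [h0] using hB0
  -- The derivative is available only at positive times, so the comparison starts at `ε` and
  -- continuity at `0` gives the limit.
  have key : ∀ ε ∈ Ioo 0 s, ‖f s‖ ≤ ‖f ε‖ + (B s - B ε) := by
    intro ε hε
    refine image_norm_le_of_norm_deriv_right_le_deriv_boundary (a := ε) (b := s) (f' := f')
      (B := fun x => ‖f ε‖ + (B x - B ε)) (B' := B')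
      (hf.mono fun x hx => hε.1.le.trans hx.1)
      (fun x hx => (hd x (hε.1.trans_le hx.1)).hasDerivWithinAt) (by simp)
      (fun x => ((hB x).sub_const _).const_add _)
      (fun x hx => hle x ⟨hε.1.le.trans hx.1, hx.2.le.trans hs.2⟩) ⟨hε.2.le, le_rfl⟩
  have hlim : Tendsto (fun ε => ‖f ε‖ + (B s - B ε)) (𝓝[>] 0) (𝓝 (‖f 0‖ + (B s - B 0))) := by
    refine Tendsto.add ?_ ?_
    · exact ((hf 0 self_mem_Ici).mono Ioi_subset_Ici_self).norm
    · exact tendsto_const_nhds.sub ((hB 0).continuousAt.tendsto.mono_left nhdsWithin_le_nhds)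
  have := ge_of_tendsto hlim (by
    filter_upwards [Ioo_mem_nhdsGT hs0] with ε hε using key ε hε)
  rw [h0, norm_zero] at this
  linarith

section Uniqueness

variable {V : Type*} [NormedAddCommGroup V] [NormedSpace ℝ V] [FiniteDimensional ℝ V]
  [MeasurableSpace V] {μ : Measure V} {ι : Type*} [Fintype ι]

theorem norm_integral_mul_le_of_tsupport_subset {w g : V → ℂ} {R G : ℝ}
    (hw : LocallyIntegrable w μ) (hg : tsupport g ⊆ Metric.closedBall 0 R)
    (hG : ∀ ξ, ‖g ξ‖ ≤ G) :
    ‖∫ ξ, w ξ * g ξ ∂μ‖ ≤ (∫ ξ in Metric.closedBall 0 R, ‖w ξ‖ ∂μ) * G := by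
  have : ∫ ξ, w ξ * g ξ ∂μ = ∫ ξ in Metric.closedBall 0 R, w ξ * g ξ ∂μ := by
    refine (setIntegral_eq_integral_of_forall_compl_eq_zero fun ξ hξ => ?_).symm
    rw [image_eq_zero_of_notMem_tsupport fun h => hξ (hg h), mul_zero]
  have : ProperSpace V := FiniteDimensional.proper_real V
  have hi : IntegrableOn w (Metric.closedBall 0 R) μ :=
    hw.integrableOn_isCompact (isCompact_closedBall _ _)
  rw [‹∫ ξ, w ξ * g ξ ∂μ = _›, ← integral_mul_const]
  refine norm_integral_le_of_norm_le (hi.norm.mul_const G) (.of_forall fun ξ => ?_)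
  rw [norm_mul]
  exact mul_le_mul_of_nonneg_left (hG ξ) (norm_nonneg _)

variable [BorelSpace V]

/-- Uniqueness for a system of ordinary differential equations with a parameter, when the
equations hold only after testing in the parameter. -/
theorem ae_eq_zero_of_weak_ode {A : ι → ι → V → ℂ} (hA : ∀ i l, ContDiff ℝ ∞ (A i l))
    {w : ℝ → ι → V → ℂ} (hw : ∀ s, 0 ≤ s → ∀ i, LocallyIntegrable (w s i) μ)
    (hb : ∀ T R : ℝ, ∃ C, ∀ s ∈ Icc 0 T, ∀ i, ∫ ξ in Metric.closedBall 0 R, ‖w s i ξ‖ ∂μ ≤ C)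
    (hc : ∀ g : V → ℂ, ContDiff ℝ ∞ g → HasCompactSupport g → ∀ i,
      ContinuousOn (fun s => ∫ ξ, w s i ξ * g ξ ∂μ) (Ici 0))
    (h0 : ∀ i, w 0 i =ᵐ[μ] 0)
    (hd : ∀ g : V → ℂ, ContDiff ℝ ∞ g → HasCompactSupport g → ∀ i t, 0 < t →
      HasDerivAt (fun s => ∫ ξ, w s i ξ * g ξ ∂μ) (∑ l, ∫ ξ, w t l ξ * (A i l ξ * g ξ) ∂μ) t)
    {t : ℝ} (ht : 0 ≤ t) (i : ι) : w t i =ᵐ[μ] 0 := by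
  have : ProperSpace V := FiniteDimensional.proper_real V
  have key : ∀ g : V → ℂ, ContDiff ℝ ∞ g → HasCompactSupport g → ∫ ξ, w t i ξ * g ξ ∂μ = 0 := by
    intro g hg hgs
    obtain ⟨R, hR⟩ := hgs.isBounded.subset_closedBall 0
    obtain ⟨C₀, hC₀⟩ := hb t R
    obtain ⟨M, hM0, hM⟩ : ∃ M : ℝ, 0 ≤ M ∧ ∀ i l, ∀ ξ ∈ Metric.closedBall (0 : V) R,
        ‖A i l ξ‖ ≤ M := by
      have : ∀ p : ι × ι, ∃ M, ∀ ξ ∈ Metric.closedBall (0 : V) R, ‖A p.1 p.2 ξ‖ ≤ M := fun p =>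
        (isCompact_closedBall (0 : V) R).exists_bound_of_continuousOn
          (hA p.1 p.2).continuous.continuousOn
      choose m hm using this
      refine ⟨∑ p, |m p|, Finset.sum_nonneg fun _ _ => abs_nonneg _, fun i l ξ hξ => ?_⟩
      refine (hm (i, l) ξ hξ).trans ((le_abs_self _).trans ?_)
      exact Finset.single_le_sum (f := fun p => |m p|) (fun _ _ => abs_nonneg _)
        (Finset.mem_univ _)
    -- One differentiation replaces `g` by the functions `A i l * g`: their supports stay in the
    -- same ball, their sup norms grow by at most `M`, and there are `card ι` of them.
    set k : ℝ := Fintype.card ι * M with hk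
    set C := max C₀ 0 with hCdef
    -- Picard iteration in duality: the bound is proved for all test functions supported in the ball
    -- at once, so that the induction hypothesis applies to `A i l * g`. The case `N = 0` is the
    -- uniform local `L¹` bound, and each integration in time gains a factor `k * s / N`.
    have claim : ∀ N : ℕ, ∀ g : V → ℂ, ContDiff ℝ ∞ g → HasCompactSupport g →
        tsupport g ⊆ Metric.closedBall 0 R → ∀ G, 0 ≤ G → (∀ ξ, ‖g ξ‖ ≤ G) → ∀ i, ∀ s ∈ Icc 0 t,
        ‖∫ ξ, w s i ξ * g ξ ∂μ‖ ≤ C * G * (k ^ N * (s ^ N / N.factorial)) := by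
      intro N
      induction N with
      | zero =>
        intro g hg _ hgR G hG0 hG i s hs
        refine (norm_integral_mul_le_of_tsupport_subset (hw s hs.1 i) hgR hG).trans ?_
        simp only [pow_zero, Nat.factorial_zero, Nat.cast_one, div_one, mul_one]
        exact mul_le_mul_of_nonneg_right ((hC₀ s hs i).trans (le_max_left _ _)) hG0
      | succ N ih =>
        intro g hg hgs hgR G hG0 hG i s hs
        have hB : ∀ x : ℝ, HasDerivAt
            (fun x => C * G * (k ^ (N + 1) * (x ^ (N + 1) / (N + 1).factorial)))
            (C * G * (k ^ (N + 1) * (x ^ N / N.factorial))) x := by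
          intro x
          convert! ((((hasDerivAt_pow (N + 1) x).div_const ((N + 1).factorial : ℝ)).const_mul
            (k ^ (N + 1))).const_mul (C * G)) using 1
          rw [Nat.factorial_succ]
          have : (N.factorial : ℝ) ≠ 0 := by positivity
          push_cast
          field_simp
        refine norm_le_of_norm_deriv_le (T := t) (hc g hg hgs i) ?_ (by simp)
          (fun x hx => hd g hg hgs i x hx) hB ?_ hs
        · rw [← integral_zero V ℂ (μ := μ)]
          refine integral_congr_ae ?_
          filter_upwards [h0 i] with ξ hξ
          rw [hξ, Pi.zero_apply, zero_mul]
        · intro x hx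
          refine (norm_sum_le _ _).trans ?_
          have hl : ∀ l, ‖∫ ξ, w x l ξ * (A i l ξ * g ξ) ∂μ‖
              ≤ C * (M * G) * (k ^ N * (x ^ N / N.factorial)) := by
            intro l
            refine ih (fun ξ => A i l ξ * g ξ) ((hA i l).mul hg) hgs.mul_left
              ((tsupport_mul_subset_right (f := A i l) (g := g)).trans hgR)
              (M * G) (by positivity) ?_ l x hx
            intro ξ
            by_cases hξ : ξ ∈ Metric.closedBall (0 : V) R
            · rw [norm_mul]
              exact mul_le_mul (hM i l ξ hξ) (hG ξ) (norm_nonneg _) hM0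
            · rw [image_eq_zero_of_notMem_tsupport fun h => hξ (hgR h), mul_zero, norm_zero]
              positivity
          refine (Finset.sum_le_sum fun l _ => hl l).trans (le_of_eq ?_)
          rw [Finset.sum_const, Finset.card_univ, nsmul_eq_mul, pow_succ]
          ring_nf
          rw [hk]
          ring
    obtain ⟨G, hG⟩ := hg.continuous.bounded_above_of_compact_support hgs
    have hG0 : 0 ≤ G := (norm_nonneg _).trans (hG 0)
    have hlim : Tendsto (fun N : ℕ => C * G * ((k * t) ^ N / N.factorial)) atTop (𝓝 0) := by
      simpa using (FloorSemiring.tendsto_pow_div_factorial_atTop (k * t)).const_mul (C * G)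
    refine norm_le_zero_iff.1 (ge_of_tendsto' hlim fun N => ?_)
    refine (claim N g hg hgs hR G hG0 hG i t ⟨ht, le_rfl⟩).trans (le_of_eq ?_)
    rw [mul_pow k t, mul_div_assoc]
  refine ae_eq_zero_of_integral_contDiff_smul_eq_zero (hw t ht i) fun g hg hgs => ?_
  have := key (fun ξ => (g ξ : ℂ)) (Complex.ofRealCLM.contDiff.comp hg)
    (hgs.comp_left Complex.ofReal_zero)
  rw [← this]
  congr 1
  ext ξ
  rw [Complex.real_smul, mul_comm]

end Uniqueness

end LinearizedNS

/-! ### The matrix exponential flow as a weak solution -/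

namespace LinearizedNS

open scoped ContDiff Topology
open Filter Set

section Flow

variable {V : Type*} {ι : Type*} [Fintype ι]
  [DecidableEq ι]

/-- The continuous linear map given by a complex matrix. -/
noncomputable def matrixCLM (M : Matrix ι ι ℂ) : (ι → ℂ) →L[ℂ] (ι → ℂ) :=
  LinearMap.toContinuousLinearMap (Matrix.toLin' M)

theorem matrixCLM_apply (M : Matrix ι ι ℂ) (u : ι → ℂ) : matrixCLM M u = M.mulVec u := by
  simp [matrixCLM]

theorem continuous_matrixCLM : Continuous (matrixCLM (ι := ι)) :=
  (LinearMap.toContinuousLinearMap.toLinearMap ∘ₗ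
    (Matrix.toLin' (R := ℂ) (m := ι) (n := ι)).toLinearMap).continuous_of_finiteDimensional

/-- The solution at time `t` of `u' = A(ξ) u`, `u(0) = u₀`. -/
noncomputable def flow (A : V → Matrix ι ι ℂ) (t : ℝ) (ξ : V) (u₀ : ι → ℂ) : ι → ℂ :=
  NormedSpace.exp ((t : ℂ) • matrixCLM (A ξ)) u₀

theorem flow_zero (A : V → Matrix ι ι ℂ) (ξ : V) (u₀ : ι → ℂ) : flow A 0 ξ u₀ = u₀ := by
  have h : ((0 : ℝ) : ℂ) • matrixCLM (A ξ) = 0 := by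
    ext u j
    simp
  rw [flow, h, NormedSpace.exp_zero]
  rfl

theorem hasDerivAt_flow (A : V → Matrix ι ι ℂ) (ξ : V) (u₀ : ι → ℂ) (t : ℝ) :
    HasDerivAt (fun s => flow A s ξ u₀) ((A ξ).mulVec (flow A t ξ u₀)) t := by
  have h := (hasDerivAt_exp_smul_const' (𝕂 := ℂ)
    (matrixCLM (A ξ)) (t : ℂ)).scomp t
    Complex.ofRealCLM.hasDerivAt
  have h2 := ((ContinuousLinearMap.apply ℂ (ι → ℂ) u₀).restrictScalars
    ℝ).hasFDerivAt.comp_hasDerivAt t h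
  convert! h2 using 1
  have h1 : Complex.ofRealCLM 1 = 1 := by simp
  rw [h1, one_smul, ← matrixCLM_apply]
  rfl

variable [NormedAddCommGroup V]

theorem continuous_flow {A : V → Matrix ι ι ℂ} (hA : Continuous A) :
    Continuous fun p : ℝ × V => NormedSpace.exp
      ((p.1 : ℂ) • matrixCLM (A p.2)) := by
  let _ : NormedAlgebra ℚ ((ι → ℂ) →L[ℂ] (ι → ℂ)) := NormedAlgebra.restrictScalars ℚ ℂ _
  refine (NormedSpace.exp_continuous (𝔸 := (ι → ℂ) →L[ℂ] (ι → ℂ))).comp ?_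
  exact (Complex.continuous_ofReal.comp continuous_fst).smul (continuous_matrixCLM.comp (hA.comp continuous_snd))

/-- The operator exponential is jointly continuous in time and frequency, hence bounded on compact
sets. This supplies the local integrability and the domination used below. -/
theorem exists_norm_flow_le [ProperSpace V] {A : V → Matrix ι ι ℂ} (hA : Continuous A)
    (T R : ℝ) : ∃ C, 0 ≤ C ∧ ∀ s ∈ Icc (-T) T, ∀ ξ ∈ Metric.closedBall (0 : V) R, ∀ u₀ : ι → ℂ,
      ‖flow A s ξ u₀‖ ≤ C * ‖u₀‖ := by
  obtain ⟨C, hC⟩ := (isCompact_Icc.prod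
    (isCompact_closedBall (0 : V) R)).exists_bound_of_continuousOn (continuous_flow hA).continuousOn (s := Icc (-T) T ×ˢ Metric.closedBall (0 : V) R)
  refine ⟨max C 0, le_max_right _ _, fun s hs ξ hξ u₀ => ?_⟩
  refine (ContinuousLinearMap.le_opNorm _ _).trans ?_
  exact mul_le_mul_of_nonneg_right ((hC (s, ξ) ⟨hs, hξ⟩).trans (le_max_left _ _)) (norm_nonneg _)

variable [MeasurableSpace V] [BorelSpace V] {μ : Measure V}

theorem aestronglyMeasurable_flow {A : V → Matrix ι ι ℂ} (hA : Continuous A) (t : ℝ)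
    {u₀ : V → ι → ℂ} (hu : AEStronglyMeasurable u₀ μ) :
    AEStronglyMeasurable (fun ξ => flow A t ξ (u₀ ξ)) μ := by
  have h1 : Continuous fun ξ : V => NormedSpace.exp
      ((t : ℂ) • matrixCLM (A ξ)) :=
    (continuous_flow hA).comp (Continuous.prodMk_right t)
  have h2 : Continuous fun p : ((ι → ℂ) →L[ℂ] (ι → ℂ)) × (ι → ℂ) => p.1 p.2 := by fun_prop
  exact h2.comp_aestronglyMeasurable (h1.aestronglyMeasurable.prodMk hu)

theorem locallyIntegrable_flow [ProperSpace V] {A : V → Matrix ι ι ℂ} (hA : Continuous A) (t : ℝ)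
    {u₀ : V → ι → ℂ} (hu : LocallyIntegrable u₀ μ) :
    LocallyIntegrable (fun ξ => flow A t ξ (u₀ ξ)) μ := by
  refine (locallyIntegrable_iff).2 fun K hK => ?_
  obtain ⟨R, hR⟩ := hK.isBounded.subset_closedBall 0
  obtain ⟨C, hC0, hC⟩ := exists_norm_flow_le hA |t| R
  refine Integrable.mono' ((hu.integrableOn_isCompact hK).norm.const_mul C)
    (aestronglyMeasurable_flow hA t hu.aestronglyMeasurable.restrict) ?_
  filter_upwards [ae_restrict_mem hK.measurableSet] with ξ hξ
  exact hC t ⟨neg_abs_le t, le_abs_self t⟩ ξ (hR hξ) _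

/-- The flow satisfies the same tested equations as the transform of a solution, so that their
difference falls under the uniqueness theorem. Differentiation under the integral is dominated
because `g` has compact support. -/
theorem hasDerivAt_integral_flow_mul [ProperSpace V] {A : V → Matrix ι ι ℂ} (hA : Continuous A)
    {u₀ : V → ι → ℂ} (hu : LocallyIntegrable u₀ μ) {g : V → ℂ} (hg : Continuous g)
    (hgs : HasCompactSupport g) (i : ι) (t : ℝ) :
    HasDerivAt (fun s => ∫ ξ, flow A s ξ (u₀ ξ) i * g ξ ∂μ)
      (∑ l, ∫ ξ, flow A t ξ (u₀ ξ) l * (A ξ i l * g ξ) ∂μ) t := by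
  obtain ⟨R, hR⟩ := hgs.isBounded.subset_closedBall 0
  obtain ⟨C, hC0, hC⟩ := exists_norm_flow_le hA (|t| + 1) R
  have hAil : ∀ l, Continuous fun ξ => A ξ i l := fun l => hA.matrix_elem i l
  have hcomp : ∀ s l, LocallyIntegrable (fun ξ => flow A s ξ (u₀ ξ) l) μ := fun s l => by
    refine (locallyIntegrable_flow hA s hu).mono
      ((continuous_apply l).comp_aestronglyMeasurable
        (aestronglyMeasurable_flow hA s hu.aestronglyMeasurable)) (.of_forall fun ξ => ?_)
    exact norm_le_pi_norm _ l
  have hint : ∀ s l {h : V → ℂ}, Continuous h → HasCompactSupport h →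
      Integrable (fun ξ => flow A s ξ (u₀ ξ) l * h ξ) μ := fun s l h hh hs =>
    (hcomp s l).integrable_smul_right_of_hasCompactSupport hh hs
  have hint2 : ∀ l, Integrable (fun ξ => flow A t ξ (u₀ ξ) l * (A ξ i l * g ξ)) μ := fun l =>
    hint t l ((hAil l).mul hg) hgs.mul_left
  rw [← integral_finsetSum _ fun l _ => hint2 l]
  have hmv : ∀ s ξ, (A ξ).mulVec (flow A s ξ (u₀ ξ)) i * g ξ
      = ∑ l, flow A s ξ (u₀ ξ) l * (A ξ i l * g ξ) := fun s ξ => by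
    simp only [Matrix.mulVec, dotProduct, Finset.sum_mul]
    exact Finset.sum_congr rfl fun l _ => by ring
  have hb : Integrable (fun ξ => ∑ l, C * (‖u₀ ξ‖ * ‖A ξ i l * g ξ‖)) μ := by
    have hn : LocallyIntegrable (fun ξ => ‖u₀ ξ‖) μ :=
      hu.mono hu.aestronglyMeasurable.norm (.of_forall fun ξ => by simp)
    refine integrable_finsetSum _ fun l _ => Integrable.const_mul ?_ C
    exact (hn.integrable_smul_right_of_hasCompactSupport
      ((hAil l).mul hg).norm (hgs.mul_left (f := fun ξ => A ξ i l)).norm)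
  refine (hasDerivAt_integral_of_dominated_loc_of_deriv_le (Metric.ball_mem_nhds t one_pos)
    (bound := fun ξ => ∑ l, C * (‖u₀ ξ‖ * ‖A ξ i l * g ξ‖))
    (F' := fun s ξ => ∑ l, flow A s ξ (u₀ ξ) l * (A ξ i l * g ξ))
    (.of_forall fun s => (hint s i hg hgs).aestronglyMeasurable) (hint t i hg hgs)
    (integrable_finsetSum _ fun l _ => hint2 l).aestronglyMeasurable
    (.of_forall fun ξ s hs => ?_) hb (.of_forall fun ξ s _ => ?_)).2
  · refine (norm_sum_le _ _).trans (Finset.sum_le_sum fun l _ => ?_)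
    rw [norm_mul, ← mul_assoc]
    by_cases hξ : ξ ∈ Metric.closedBall (0 : V) R
    · refine mul_le_mul_of_nonneg_right ((norm_le_pi_norm _ l).trans (hC s ?_ ξ hξ _))
        (norm_nonneg _)
      rw [Metric.mem_ball, Real.dist_eq] at hs
      have h1 : |s| ≤ |t| + 1 := by
        have := abs_sub_abs_le_abs_sub s t
        linarith
      exact abs_le.1 h1
    · rw [image_eq_zero_of_notMem_tsupport fun h => hξ (hR h)]
      simp
  · rw [← hmv]
    exact (hasDerivAt_pi.1 (hasDerivAt_flow A ξ (u₀ ξ) s) i).mul_const _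

end Flow

end LinearizedNS

/-! ### Identification of a solution with the flow of its symbol -/

namespace LinearizedNS

open scoped ContDiff Topology FourierTransform Real
open Filter Set

variable {n : ℕ} {α β γ : ℝ} {ρ₀ : Lp ℝ 2 (volume : Measure (E n))}
  {v₀ : Lp (E n) 2 (volume : Measure (E n))} {ρ : ℝ → Lp ℝ 2 (volume : Measure (E n))}
  {v : ℝ → Lp (E n) 2 (volume : Measure (E n))}

theorem contDiff_symbol (a b c : ℝ) (i l : Option (Fin n)) :
    ContDiff ℝ ∞ fun ξ : E n => symbol a b c ξ i l := by
  have hc : ∀ k : Fin n, ContDiff ℝ ∞ fun ξ : E n => (ξ k : ℂ) := fun k =>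
    (Complex.ofRealCLM ∘L (EuclideanSpace.proj k : E n →L[ℝ] ℝ)).contDiff
  have hn : ContDiff ℝ ∞ fun ξ : E n => ((a * ‖ξ‖ ^ 2 : ℝ) : ℂ) :=
    Complex.ofRealCLM.contDiff.comp (contDiff_const.mul (contDiff_norm_sq ℝ))
  cases i with
  | none =>
    cases l with
    | none => exact contDiff_const
    | some k => exact (contDiff_const.mul (hc k)).neg
  | some j =>
    cases l with
    | none => exact (contDiff_const.mul (hc j)).neg
    | some k =>
      by_cases hjk : j = k
      · simp only [symbol, hjk, if_true]
        exact (hn.add (contDiff_const.mul ((hc k).mul (hc k)))).neg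
      · simp only [symbol, hjk, if_false]
        exact (contDiff_const.add (contDiff_const.mul ((hc j).mul (hc k)))).neg

theorem continuous_symbol (a b c : ℝ) : Continuous (symbol a b c : E n → _) :=
  continuous_matrix fun i l => (contDiff_symbol a b c i l).continuous

theorem continuous_spec : Continuous (spec (n := n)) :=
  (Lp.fourierTransformₗᵢ (E n) ℂ).continuous.comp
    (Complex.ofRealCLM.compLpL 2 (volume : Measure (E n))).continuous

theorem continuous_component (j : Fin n) : Continuous (component j) :=
  ((EuclideanSpace.proj j : E n →L[ℝ] ℝ).compLpL 2 (volume : Measure (E n))).continuous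

theorem IsSolution.continuousOn_specState (h : IsSolution α β γ ρ₀ v₀ ρ v) (i : Option (Fin n)) :
    ContinuousOn (fun s => specState (ρ s) (v s) i) (Ici 0) := by
  cases i with
  | none => exact continuous_spec.comp_continuousOn h.continuousOn_density
  | some j =>
    exact (continuous_spec.comp (continuous_component j)).comp_continuousOn h.continuousOn_velocity

theorem continuous_integral_mul {V : Type*} [MeasurableSpace V] {μ : Measure V} {g : V → ℂ}
    (hg : MemLp g 2 μ) : Continuous fun f : Lp ℂ 2 μ => ∫ ξ, f ξ * g ξ ∂μ := by
  have : (fun f : Lp ℂ 2 μ => ∫ ξ, f ξ * g ξ ∂μ) = fun f => inner ℂ (hg.star.toLp (star g)) f := by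
    ext f
    rw [L2.inner_def]
    refine integral_congr_ae ?_
    filter_upwards [hg.star.coeFn_toLp] with ξ hξ
    rw [hξ]
    simp [RCLike.inner_apply]
  rw [this]
  fun_prop

theorem integral_norm_sq_eq {V F : Type*} [MeasurableSpace V] {μ : Measure V}
    [NormedAddCommGroup F] (f : Lp F 2 μ) : ∫ ξ, ‖f ξ‖ ^ 2 ∂μ = ‖f‖ ^ 2 := by
  rw [Lp.norm_def, (Lp.memLp f).eLpNorm_eq_integral_rpow_norm (by simp) (by simp)]
  rw [ENNReal.toReal_ofReal (by positivity)]
  simp only [ENNReal.toReal_ofNat, Real.rpow_ofNat]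
  have h0 : 0 ≤ ∫ ξ, ‖f ξ‖ ^ 2 ∂μ := integral_nonneg fun _ => by positivity
  rw [← Real.rpow_natCast, ← Real.rpow_mul h0]
  norm_num

theorem integrable_norm_sq {V F : Type*} [MeasurableSpace V] {μ : Measure V}
    [NormedAddCommGroup F] (f : Lp F 2 μ) : Integrable (fun ξ => ‖f ξ‖ ^ 2) μ :=
  (Lp.memLp f).integrable_norm_pow (by simp)

theorem locallyIntegrable_lp_two (f : Lp ℂ 2 (volume : Measure (E n))) : LocallyIntegrable f :=
  (Lp.memLp f).locallyIntegrable (by norm_num)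

/-- Uses `s ≤ 1 + s ^ 2`, which avoids Cauchy–Schwarz; only some bound by the `L²` norm is needed.
-/
theorem setIntegral_norm_le (f : Lp ℂ 2 (volume : Measure (E n))) (R : ℝ) :
    ∫ ξ in Metric.closedBall 0 R, ‖f ξ‖ ≤
      volume.real (Metric.closedBall (0 : E n) R) + ‖f‖ ^ 2 := by
  have hi : IntegrableOn f (Metric.closedBall (0 : E n) R) :=
    (locallyIntegrable_lp_two f).integrableOn_isCompact (isCompact_closedBall _ _)
  have h1 : IntegrableOn (fun _ : E n => (1 : ℝ)) (Metric.closedBall (0 : E n) R) :=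
    integrableOn_const measure_closedBall_lt_top.ne
  have h2 := (integrable_norm_sq f).integrableOn (s := Metric.closedBall (0 : E n) R)
  calc ∫ ξ in Metric.closedBall 0 R, ‖f ξ‖
      ≤ ∫ ξ in Metric.closedBall 0 R, (1 + ‖f ξ‖ ^ 2) := by
        refine setIntegral_mono hi.norm (h1.add h2) fun ξ => ?_
        change _ ≤ 1 + ‖f ξ‖ ^ 2
        nlinarith [sq_nonneg (‖f ξ‖ - 1), sq_nonneg ‖f ξ‖]
    _ = volume.real (Metric.closedBall (0 : E n) R) +
        ∫ ξ in Metric.closedBall 0 R, ‖f ξ‖ ^ 2 := by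
        rw [integral_add h1 h2]
        simp
    _ ≤ _ := by
        rw [← integral_norm_sq_eq f]
        gcongr
        · exact .of_forall fun ξ => by positivity
        · exact integrable_norm_sq f
        · exact Measure.restrict_le_self

/-- The Fourier transform of a solution is obtained from that of the initial data by the flow of
the symbol. -/
theorem IsSolution.specState_eq_flow (h : IsSolution α β γ ρ₀ v₀ ρ v) {t : ℝ} (ht : 0 ≤ t) :
    ∀ᵐ ξ : E n, ∀ i, specState (ρ t) (v t) i ξ =
      flow (symbol (4 * π ^ 2 * α) (4 * π ^ 2 * β) (2 * π * γ)) t ξ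
        (fun l => specState ρ₀ v₀ l ξ) i := by
  set A : E n → _ := symbol (n := n) (4 * π ^ 2 * α) (4 * π ^ 2 * β) (2 * π * γ) with hA
  set u₀ : E n → Option (Fin n) → ℂ := fun ξ l => specState ρ₀ v₀ l ξ with hu₀
  have hAc : Continuous A := continuous_symbol _ _ _
  have hul : LocallyIntegrable u₀ := by
    refine locallyIntegrable_iff.2 fun K hK => ?_
    exact Integrable.of_eval fun i => (locallyIntegrable_lp_two _).integrableOn_isCompact hK
  have hcomp : ∀ s l, LocallyIntegrable (fun ξ => flow A s ξ (u₀ ξ) l) := fun s l =>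
    (locallyIntegrable_flow hAc s hul).mono
      ((continuous_apply l).comp_aestronglyMeasurable
        (aestronglyMeasurable_flow hAc s hul.aestronglyMeasurable))
      (.of_forall fun ξ => norm_le_pi_norm _ l)
  have hint : ∀ {w g : E n → ℂ}, LocallyIntegrable w → Continuous g → HasCompactSupport g →
      Integrable (fun ξ => w ξ * g ξ) := fun hw hg hgs =>
    hw.integrable_smul_right_of_hasCompactSupport hg hgs
  have hsplit : ∀ {g : E n → ℂ}, Continuous g → HasCompactSupport g → ∀ s l,
      ∫ ξ, (specState (ρ s) (v s) l ξ - flow A s ξ (u₀ ξ) l) * g ξ =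
        (∫ ξ, specState (ρ s) (v s) l ξ * g ξ) - ∫ ξ, flow A s ξ (u₀ ξ) l * g ξ := by
    intro g hg hgs s l
    rw [← integral_sub (hint (locallyIntegrable_lp_two _) hg hgs) (hint (hcomp s l) hg hgs)]
    simp only [sub_mul]
  have key := fun i => ae_eq_zero_of_weak_ode (μ := (volume : Measure (E n)))
    (A := fun i l ξ => A ξ i l) (fun i l => contDiff_symbol _ _ _ i l)
    (w := fun s i ξ => specState (ρ s) (v s) i ξ - flow A s ξ (u₀ ξ) i)
    (fun s _ i => (locallyIntegrable_lp_two _).sub (hcomp s i)) ?_ ?_ ?_ ?_ ht i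
  · rw [eventually_all]
    intro i
    filter_upwards [key i] with ξ hξ
    exact sub_eq_zero.1 hξ
  · intro T R
    have hbd : ∀ i, ∃ C, ∀ s ∈ Icc 0 T, ‖specState (ρ s) (v s) i‖ ≤ C := fun i =>
      isCompact_Icc.exists_bound_of_continuousOn
        ((h.continuousOn_specState i).mono Icc_subset_Ici_self)
    choose C hC using hbd
    obtain ⟨D, hD0, hD⟩ := exists_norm_flow_le hAc T R
    set K := Metric.closedBall (0 : E n) R with hK
    have hKc : IsCompact K := isCompact_closedBall _ _
    refine ⟨volume.real K + ∑ i, C i ^ 2 + D * ∫ ξ in K, ‖u₀ ξ‖, fun s hs i => ?_⟩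
    have i1 := ((locallyIntegrable_lp_two (specState (ρ s) (v s) i)).integrableOn_isCompact
      hKc).norm
    have i2 := ((hcomp s i).integrableOn_isCompact hKc).norm
    have i3 := ((hul.integrableOn_isCompact hKc).norm).const_mul D
    calc ∫ ξ in K, ‖specState (ρ s) (v s) i ξ - flow A s ξ (u₀ ξ) i‖
        ≤ ∫ ξ in K, (‖specState (ρ s) (v s) i ξ‖ + ‖flow A s ξ (u₀ ξ) i‖) :=
          setIntegral_mono (((locallyIntegrable_lp_two _).integrableOn_isCompact hKc).sub
            ((hcomp s i).integrableOn_isCompact hKc)).norm (i1.add i2) fun ξ => norm_sub_le _ _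
      _ = (∫ ξ in K, ‖specState (ρ s) (v s) i ξ‖) + ∫ ξ in K, ‖flow A s ξ (u₀ ξ) i‖ :=
          integral_add i1 i2
      _ ≤ (volume.real K + ∑ i, C i ^ 2) + D * ∫ ξ in K, ‖u₀ ξ‖ := by
          refine add_le_add ((setIntegral_norm_le _ _).trans ?_) ?_
          · gcongr
            refine le_trans ?_ (Finset.single_le_sum (f := fun i => C i ^ 2)
              (fun _ _ => sq_nonneg _) (Finset.mem_univ i))
            exact pow_le_pow_left₀ (norm_nonneg _) (hC i s hs) 2
          · rw [← integral_const_mul]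
            refine setIntegral_mono_on i2 i3 hKc.measurableSet fun ξ hξ => ?_
            exact (norm_le_pi_norm _ i).trans (hD s ⟨by linarith [hs.1, hs.2], hs.2⟩ ξ hξ _)
  · intro g hg hgs i
    simp only [hsplit hg.continuous hgs]
    refine ContinuousOn.sub ?_ ?_
    · exact (continuous_integral_mul
        (hg.continuous.memLp_of_hasCompactSupport hgs)).comp_continuousOn (h.continuousOn_specState i)
    · exact (continuous_iff_continuousAt.2 fun s =>
        (hasDerivAt_integral_flow_mul hAc hul hg.continuous hgs i s).continuousAt).continuousOn
  · intro i
    refine .of_forall fun ξ => ?_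
    simp only [flow_zero, h.initial_density, h.initial_velocity, hu₀, sub_self, Pi.zero_apply]
  · intro g hg hgs i t ht
    have h1 := h.hasDerivAt_specState (hgs.toSchwartzMap hg) i ht
    have h2 := hasDerivAt_integral_flow_mul hAc hul hg.continuous hgs i t
    have h3 := h1.sub h2
    simp only [hsplit hg.continuous hgs]
    convert! h3 using 1
    rw [← Finset.sum_sub_distrib]
    refine Finset.sum_congr rfl fun l _ => ?_
    exact hsplit (g := fun ξ => A ξ i l * g ξ) ((hAc.matrix_elem i l).mul hg.continuous)
      hgs.mul_left t l

end LinearizedNS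

/-! ### Dynamics of a single Fourier mode -/

namespace LinearizedNS

open scoped Topology ComplexConjugate
open Filter Set

variable {n : ℕ}

/-- The longitudinal part `ξ · v` of a Fourier mode. -/
noncomputable def longitudinal (ξ : E n) (u : Option (Fin n) → ℂ) : ℂ :=
  ∑ k, (ξ k : ℂ) * u (some k)

theorem symbol_mulVec_none (a b c : ℝ) (ξ : E n) (u : Option (Fin n) → ℂ) :
    (symbol a b c ξ).mulVec u none = -(Complex.I * c * longitudinal ξ u) := by
  simp only [Matrix.mulVec, dotProduct, Fintype.sum_option, symbol, longitudinal, zero_mul,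
    zero_add, Finset.mul_sum, ← Finset.sum_neg_distrib]
  exact Finset.sum_congr rfl fun k _ => by ring

theorem symbol_mulVec_some (a b c : ℝ) (ξ : E n) (u : Option (Fin n) → ℂ) (j : Fin n) :
    (symbol a b c ξ).mulVec u (some j) = -(a * ‖ξ‖ ^ 2 * u (some j) + b * ξ j * longitudinal ξ u
      + Complex.I * c * ξ j * u none) := by
  simp only [Matrix.mulVec, dotProduct, Fintype.sum_option, symbol, longitudinal, Finset.mul_sum]
  have : ∀ k : Fin n, -(((if j = k then a * ‖ξ‖ ^ 2 else 0 : ℝ) : ℂ) + b * (ξ j * ξ k))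
      * u (some k) = -(if j = k then (a * ‖ξ‖ ^ 2 : ℝ) * u (some j) else 0)
        - b * ξ j * (ξ k * u (some k)) := by
    intro k
    split_ifs with h
    · subst h; ring
    · push_cast; ring
  simp only [this, Finset.sum_sub_distrib, Finset.sum_neg_distrib, Finset.sum_ite_eq,
    Finset.mem_univ, if_true]
  push_cast
  ring

theorem ofReal_norm_sq (ξ : E n) : ((‖ξ‖ : ℂ)) ^ 2 = ∑ k, (ξ k : ℂ) ^ 2 := by
  rw [← Complex.ofReal_pow, EuclideanSpace.real_norm_sq_eq]
  push_cast
  rfl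

/-- The density and the longitudinal part form a closed two-dimensional system, with damping `a + b`
instead of `a`. -/
theorem longitudinal_symbol_mulVec (a b c : ℝ) (ξ : E n) (u : Option (Fin n) → ℂ) :
    longitudinal ξ ((symbol a b c ξ).mulVec u) =
      -((a + b) * ‖ξ‖ ^ 2 * longitudinal ξ u + Complex.I * c * ‖ξ‖ ^ 2 * u none) := by
  conv_lhs => rw [longitudinal]
  simp only [symbol_mulVec_some]
  have : ∀ k : Fin n, (ξ k : ℂ) * -(a * ‖ξ‖ ^ 2 * u (some k) + b * ξ k * longitudinal ξ u
      + Complex.I * c * ξ k * u none) = -(a * ‖ξ‖ ^ 2 * (ξ k * u (some k))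
      + (ξ k : ℂ) ^ 2 * (b * longitudinal ξ u + Complex.I * c * u none)) := fun k => by ring
  simp only [this, Finset.sum_neg_distrib, Finset.sum_add_distrib, ← Finset.mul_sum,
    ← Finset.sum_mul, ← ofReal_norm_sq]
  rw [← longitudinal]
  ring

/-- The energy of the velocity part of a Fourier mode. -/
noncomputable def kinetic (u : Option (Fin n) → ℂ) : ℝ := ∑ k, ‖u (some k)‖ ^ 2

theorem kinetic_nonneg (u : Option (Fin n) → ℂ) : 0 ≤ kinetic u :=
  Finset.sum_nonneg fun _ _ => sq_nonneg _

theorem norm_longitudinal_sq_le (ξ : E n) (u : Option (Fin n) → ℂ) :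
    ‖longitudinal ξ u‖ ^ 2 ≤ ‖ξ‖ ^ 2 * kinetic u := by
  have h1 : ‖longitudinal ξ u‖ ≤ ∑ k, |ξ k| * ‖u (some k)‖ := by
    refine (norm_sum_le _ _).trans (le_of_eq ?_)
    simp
  calc ‖longitudinal ξ u‖ ^ 2 ≤ (∑ k, |ξ k| * ‖u (some k)‖) ^ 2 := by gcongr
    _ ≤ (∑ k, |ξ k| ^ 2) * ∑ k, ‖u (some k)‖ ^ 2 := Finset.sum_mul_sq_le_sq_mul_sq _ _ _
    _ = _ := by simp [EuclideanSpace.real_norm_sq_eq, kinetic]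

/-- A nonnegative quantity with `L' ≤ -κ L` decays exponentially. -/
theorem le_exp_mul_of_deriv_le {L L' : ℝ → ℝ} {κ : ℝ} (hL : ∀ t, HasDerivAt L (L' t) t)
    (h : ∀ t, L' t ≤ -κ * L t) {t : ℝ} (ht : 0 ≤ t) : L t ≤ Real.exp (-κ * t) * L 0 := by
  have hd : ∀ s, HasDerivAt (fun s => Real.exp (κ * s) * L s)
      (Real.exp (κ * s) * κ * L s + Real.exp (κ * s) * L' s) s := fun s => by
    have h1 : HasDerivAt (fun s => Real.exp (κ * s)) (Real.exp (κ * s) * κ) s := by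
      simpa using ((hasDerivAt_id s).const_mul κ).exp
    exact h1.mul (hL s)
  have hanti : Antitone fun s => Real.exp (κ * s) * L s := by
    refine antitone_of_deriv_nonpos (fun s => (hd s).differentiableAt) fun s => ?_
    rw [(hd s).deriv]
    nlinarith [h s, Real.exp_pos (κ * s)]
  have := hanti ht
  simp only [mul_zero, Real.exp_zero, one_mul] at this
  rw [neg_mul, Real.exp_neg, ← div_eq_inv_mul, le_div_iff₀ (Real.exp_pos _)]
  linarith

/-- The pointwise inequality behind the decay of the modified energy. Here `m` and `k` are the
energies of the density and of the velocity, `q` is the modulus of the longitudinal part, `X` is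
the cross term and `x = |ξ|²`. -/
theorem modified_energy_dissipation {a b c ε κ x m k q X : ℝ} (ha : 0 < a) (hb : 0 ≤ b)
    (hc : 0 < c) (hε : ε * (2 * c + (a + b) ^ 2 / c) ≤ a) (hκ : 0 ≤ κ) (hκε : κ ≤ ε)
    (hκx : κ * x ≤ ε) (hx : 0 ≤ x) (hm : 0 ≤ m) (hk : 0 ≤ k) (hq : q ^ 2 ≤ x * k)
    (hX : 2 * κ * |X| ≤ (m + k) / 2) (hX2 : X ^ 2 ≤ x * m * k) :
    -2 * a * x * k - 2 * b * q ^ 2 + 2 * κ * (c * q ^ 2 - c * x * m - (a + b) * x * X)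
      ≤ -(κ * c * x / 2) * (m + k + 2 * κ * X) := by
  have hν : 0 < a + b := by linarith
  -- Weighted arithmetic–geometric mean inequality; the weights are such that the error consumes
  -- half of the density damping `2 * κ * c * x * m`, and the rest goes to the viscous term.
  have h1 : 2 * (a + b) * |X| ≤ c * m + (a + b) ^ 2 / c * x * k := by
    refine abs_le_of_sq_le_sq' (a := 2 * (a + b) * |X|) ?_ (by positivity) |>.2
    have e : 4 * (c * m) * ((a + b) ^ 2 / c * x * k) = 4 * (a + b) ^ 2 * (x * m * k) := by
      field_simp
    have e2 : (2 * (a + b) * |X|) ^ 2 = 4 * (a + b) ^ 2 * X ^ 2 := by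
      rw [mul_pow, sq_abs]; ring
    have e3 : 4 * (a + b) ^ 2 * X ^ 2 ≤ 4 * (a + b) ^ 2 * (x * m * k) := by gcongr
    nlinarith [sq_nonneg (c * m - (a + b) ^ 2 / c * x * k)]
  have hxk : 0 ≤ x * k := mul_nonneg hx hk
  have hκx0 : 0 ≤ κ * x := mul_nonneg hκ hx
  have h2 : -(2 * κ * ((a + b) * x * X)) ≤ κ * x * (c * m) + ε * ((a + b) ^ 2 / c) * (x * k) := by
    have e1 : -(2 * κ * ((a + b) * x * X)) ≤ κ * x * (2 * (a + b) * |X|) := by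
      have := mul_le_mul_of_nonneg_left (neg_abs_le X) (by positivity : 0 ≤ 2 * κ * ((a + b) * x))
      linarith
    have e2 := mul_le_mul_of_nonneg_left h1 hκx0
    have e3 := mul_le_mul_of_nonneg_right hκx
      (by positivity : 0 ≤ (a + b) ^ 2 / c * (x * k))
    linarith
  have h3 : 2 * κ * (c * q ^ 2) ≤ 2 * ε * c * (x * k) := by
    have e1 : κ * q ^ 2 ≤ ε * (x * k) := mul_le_mul hκε hq (sq_nonneg _) (hκ.trans hκε)
    have := mul_le_mul_of_nonneg_left e1 (by positivity : 0 ≤ 2 * c)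
    linarith
  have h4 := mul_le_mul_of_nonneg_right hε hxk
  have hq2 : 0 ≤ 2 * b * q ^ 2 := by positivity
  -- The viscous damping `a * x * k` left after absorbing the errors also dominates `κ * c * x * k`,
  -- so both energies decay at the same rate.
  have h5 : κ * c ≤ a := by
    have e1 : κ * c ≤ ε * c := by gcongr
    have e2 : 0 ≤ ε * c := mul_nonneg (hκ.trans hκε) hc.le
    have e3 : 0 ≤ ε * ((a + b) ^ 2 / c) := mul_nonneg (hκ.trans hκε) (by positivity)
    linarith
  have h6 := mul_le_mul_of_nonneg_right h5 hxk
  have h7 : 2 * κ * X ≤ (m + k) / 2 :=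
    (mul_le_mul_of_nonneg_left (le_abs_self X) (by positivity)).trans hX
  have h8 := mul_le_mul_of_nonneg_left h7 (by positivity : 0 ≤ κ * c * x / 2)
  have h9 : 0 ≤ κ * c * x * m := by positivity
  have h10 : 0 ≤ κ * c * x * k := by positivity
  nlinarith

section ModeODE

variable {a b c : ℝ} {ξ : E n} {u : ℝ → Option (Fin n) → ℂ}

/-- The trajectory of a single Fourier mode. -/
def IsMode (a b c : ℝ) (ξ : E n) (u : ℝ → Option (Fin n) → ℂ) : Prop :=
  ∀ t, HasDerivAt u ((symbol a b c ξ).mulVec (u t)) t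

theorem IsMode.hasDerivAt_none (h : IsMode a b c ξ u) (t : ℝ) :
    HasDerivAt (fun s => u s none) (-(Complex.I * c * longitudinal ξ (u t))) t := by
  have := hasDerivAt_pi.1 (h t) none
  rwa [symbol_mulVec_none] at this

theorem IsMode.hasDerivAt_some (h : IsMode a b c ξ u) (t : ℝ) (j : Fin n) :
    HasDerivAt (fun s => u s (some j)) (-(a * ‖ξ‖ ^ 2 * u t (some j)
      + b * ξ j * longitudinal ξ (u t) + Complex.I * c * ξ j * u t none)) t := by
  have := hasDerivAt_pi.1 (h t) (some j)
  rwa [symbol_mulVec_some] at this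

theorem IsMode.hasDerivAt_longitudinal (h : IsMode a b c ξ u) (t : ℝ) :
    HasDerivAt (fun s => longitudinal ξ (u s)) (-((a + b) * ‖ξ‖ ^ 2 * longitudinal ξ (u t)
      + Complex.I * c * ‖ξ‖ ^ 2 * u t none)) t := by
  rw [← longitudinal_symbol_mulVec]
  exact HasDerivAt.fun_sum fun k _ => (hasDerivAt_pi.1 (h t) (some k)).const_mul _

theorem hasDerivAt_norm_sq {f : ℝ → ℂ} {f' : ℂ} {t : ℝ} (h : HasDerivAt f f' t) :
    HasDerivAt (fun s => ‖f s‖ ^ 2) (2 * (conj (f t) * f').re) t := by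
  have := h.norm_sq
  rwa [Complex.inner, mul_comm f'] at this

/-- The coupling terms in `c` are skew and cancel; only the viscous terms remain, and they do not
see the density. -/
theorem IsMode.hasDerivAt_energy (h : IsMode a b c ξ u) (t : ℝ) :
    HasDerivAt (fun s => ‖u s none‖ ^ 2 + kinetic (u s))
      (-2 * a * ‖ξ‖ ^ 2 * kinetic (u t) - 2 * b * ‖longitudinal ξ (u t)‖ ^ 2) t := by
  have h1 := hasDerivAt_norm_sq (h.hasDerivAt_none t)
  have h2 := HasDerivAt.fun_sum (u := Finset.univ)
    fun k _ => hasDerivAt_norm_sq (h.hasDerivAt_some t k)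
  convert! h1.add h2 using 1
  set q := longitudinal ξ (u t) with hq
  have hterm : ∀ k, 2 * (conj (u t (some k)) * -(a * ‖ξ‖ ^ 2 * u t (some k) + b * ξ k * q
      + Complex.I * c * ξ k * u t none)).re = -2 * a * ‖ξ‖ ^ 2 * ‖u t (some k)‖ ^ 2
      + (-2 * (conj ((ξ k : ℂ) * u t (some k)) * (b * q + Complex.I * c * u t none))).re := by
    intro k
    have e : (2 : ℝ) * (conj (u t (some k)) * -(a * ‖ξ‖ ^ 2 * u t (some k) + b * ξ k * q
      + Complex.I * c * ξ k * u t none)).re = (2 * (conj (u t (some k)) *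
        -(a * ‖ξ‖ ^ 2 * u t (some k) + b * ξ k * q + Complex.I * c * ξ k * u t none))).re := by
      rw [Complex.mul_re 2]; simp
    have e2 : -2 * a * ‖ξ‖ ^ 2 * ‖u t (some k)‖ ^ 2 =
        (-2 * a * ‖ξ‖ ^ 2 * (conj (u t (some k)) * u t (some k)) : ℂ).re := by
      rw [Complex.conj_mul']
      norm_cast
    rw [e, e2, ← Complex.add_re]
    congr 1
    rw [map_mul, Complex.conj_ofReal]
    ring
  simp only [hterm]
  rw [Finset.sum_add_distrib, ← Finset.mul_sum, ← Complex.re_sum, ← Finset.mul_sum,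
    ← Finset.sum_mul, ← map_sum]
  change _ = _ + (_ * kinetic (u t) + (-2 * (conj q * _)).re)
  have e3 : ‖q‖ ^ 2 = q.re * q.re + q.im * q.im := by
    rw [← Complex.normSq_apply, Complex.normSq_eq_norm_sq]
  rw [e3]
  simp [Complex.mul_re, Complex.mul_im]
  ring

/-- The term `-c * ‖ξ‖ ^ 2 * ‖u t none‖ ^ 2` is the density damping that the plain energy lacks. -/
theorem IsMode.hasDerivAt_cross (h : IsMode a b c ξ u) (t : ℝ) :
    HasDerivAt (fun s => (conj (u s none) * longitudinal ξ (u s)).im)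
      (c * ‖longitudinal ξ (u t)‖ ^ 2 - c * ‖ξ‖ ^ 2 * ‖u t none‖ ^ 2
        - (a + b) * ‖ξ‖ ^ 2 * (conj (u t none) * longitudinal ξ (u t)).im) t := by
  have h1 := Complex.conjCLE.toContinuousLinearMap.hasFDerivAt.comp_hasDerivAt t
    (h.hasDerivAt_none t)
  have h2 := Complex.imCLM.hasFDerivAt.comp_hasDerivAt t (h1.mul (h.hasDerivAt_longitudinal t))
  convert! h2 using 1
  set q := longitudinal ξ (u t) with hq
  have e : ∀ z : ℂ, ‖z‖ ^ 2 = z.re * z.re + z.im * z.im := fun z => by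
    rw [← Complex.normSq_apply, Complex.normSq_eq_norm_sq]
  rw [e q, e (u t none)]
  have e4 : ((‖ξ‖ : ℂ) ^ 2) = ((‖ξ‖ ^ 2 : ℝ) : ℂ) := by push_cast; rfl
  rw [e4]
  generalize ‖ξ‖ ^ 2 = y
  simp [Complex.mul_re, Complex.mul_im]
  ring

theorem cross_sq_le (ξ : E n) (w : Option (Fin n) → ℂ) :
    (conj (w none) * longitudinal ξ w).im ^ 2 ≤ ‖ξ‖ ^ 2 * ‖w none‖ ^ 2 * kinetic w := by
  have h1 : |(conj (w none) * longitudinal ξ w).im| ≤ ‖w none‖ * ‖longitudinal ξ w‖ := by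
    refine (Complex.abs_im_le_norm _).trans (le_of_eq ?_)
    rw [norm_mul, Complex.norm_conj]
  have h2 := norm_longitudinal_sq_le ξ w
  calc (conj (w none) * longitudinal ξ w).im ^ 2 = |(conj (w none) * longitudinal ξ w).im| ^ 2 :=
        (sq_abs _).symm
    _ ≤ (‖w none‖ * ‖longitudinal ξ w‖) ^ 2 := by gcongr
    _ = ‖w none‖ ^ 2 * ‖longitudinal ξ w‖ ^ 2 := mul_pow _ _ _
    _ ≤ ‖w none‖ ^ 2 * (‖ξ‖ ^ 2 * kinetic w) := by gcongr
    _ = _ := by ring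

/-- Fourier modes decay like `exp (-κ |ξ|² t / (1 + |ξ|²))`. -/
theorem exists_energy_decay (a b c : ℝ) (ha : 0 < a) (hb : 0 ≤ b) (hc : 0 < c) :
    ∃ κ : ℝ, 0 < κ ∧ ∀ (ξ : E n) (u : ℝ → Option (Fin n) → ℂ), IsMode a b c ξ u → ∀ t, 0 ≤ t →
      ‖u t none‖ ^ 2 + kinetic (u t) ≤ 3 * Real.exp (-(κ * (‖ξ‖ ^ 2 / (1 + ‖ξ‖ ^ 2))) * t) *
        (‖u 0 none‖ ^ 2 + kinetic (u 0)) := by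
  set D := 2 * c + (a + b) ^ 2 / c with hD
  have hD0 : 0 < D := by positivity
  set ε := min 1 (a / D) with hεdef
  have hε0 : 0 < ε := by positivity
  have hε1 : ε ≤ 1 := min_le_left _ _
  have hεD : ε * D ≤ a := by
    rw [← le_div_iff₀ hD0]; exact min_le_right _ _
  refine ⟨ε * c / 2, by positivity, fun ξ u h t ht => ?_⟩
  set x := ‖ξ‖ ^ 2 with hx
  have hx0 : 0 ≤ x := sq_nonneg _
  -- The weight depends on the frequency: `κ ≤ ε` and `κ * x ≤ ε` control the error terms at low and
  -- high frequency, and `4 * κ ^ 2 * x ≤ 1` keeps the cross term below half of the energy.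
  set κ := ε / (1 + x) with hκ
  have hκ0 : 0 ≤ κ := by positivity
  have hκε : κ ≤ ε := div_le_self hε0.le (by linarith)
  have hκx : κ * x ≤ ε := by
    rw [hκ, div_mul_eq_mul_div, div_le_iff₀ (by linarith)]
    nlinarith
  have hκ2 : 4 * κ ^ 2 * x ≤ 1 := by
    rw [hκ, div_pow, mul_div_assoc', div_mul_eq_mul_div, div_le_one (by positivity)]
    have : ε ^ 2 ≤ 1 := pow_le_one₀ hε0.le hε1
    nlinarith [sq_nonneg (1 - x)]
  set X : ℝ → ℝ := fun s => (conj (u s none) * longitudinal ξ (u s)).im with hX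
  have hXb : ∀ s, 2 * κ * |X s| ≤ (‖u s none‖ ^ 2 + kinetic (u s)) / 2 := by
    intro s
    have hk := kinetic_nonneg (u s)
    refine abs_le_of_sq_le_sq' (a := 2 * κ * |X s|) ?_ (by positivity) |>.2
    have e1 := cross_sq_le ξ (u s)
    have e2 : (2 * κ * |X s|) ^ 2 = 4 * κ ^ 2 * X s ^ 2 := by rw [mul_pow, sq_abs]; ring
    have e3 : 4 * κ ^ 2 * X s ^ 2 ≤ 4 * κ ^ 2 * (x * ‖u s none‖ ^ 2 * kinetic (u s)) := by
      gcongr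
    have e4 := mul_le_mul_of_nonneg_right hκ2
      (by positivity : 0 ≤ ‖u s none‖ ^ 2 * kinetic (u s))
    nlinarith [sq_nonneg (‖u s none‖ ^ 2 - kinetic (u s))]
  have hL := le_exp_mul_of_deriv_le (L := fun s => ‖u s none‖ ^ 2 + kinetic (u s) + 2 * κ * X s)
    (κ := κ * c * x / 2) (fun s => (h.hasDerivAt_energy s).add
      ((h.hasDerivAt_cross s).const_mul (2 * κ)))
    (fun s => modified_energy_dissipation ha hb hc hεD hκ0 hκε hκx hx0 (sq_nonneg _)
      (kinetic_nonneg _) (norm_longitudinal_sq_le ξ (u s)) (hXb s) (cross_sq_le ξ (u s))) ht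
  have ht1 := mul_le_mul_of_nonneg_left (neg_abs_le (X t)) (by positivity : 0 ≤ 2 * κ)
  have h01 := mul_le_mul_of_nonneg_left (le_abs_self (X 0)) (by positivity : 0 ≤ 2 * κ)
  have e : -(κ * c * x / 2) * t = -(ε * c / 2 * (x / (1 + x))) * t := by rw [hκ]; ring
  rw [e] at hL
  have hXt := hXb t
  have hX0 := hXb 0
  have hE := Real.exp_pos (-(ε * c / 2 * (x / (1 + x))) * t)
  -- The modified energy lies between `1 / 2` and `3 / 2` of the energy, whence the factor `3`.
  have hL0 := mul_le_mul_of_nonneg_left (by linarith : ‖u 0 none‖ ^ 2 + kinetic (u 0) + 2 * κ * X 0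
    ≤ 3 / 2 * (‖u 0 none‖ ^ 2 + kinetic (u 0))) hE.le
  linarith

/-- The longitudinal part of a Fourier mode in the oscillatory regime. -/
theorem IsMode.longitudinal_eq (h : IsMode a b c ξ u) {μ θ : ℝ} (hμ : 2 * μ = (a + b) * ‖ξ‖ ^ 2)
    (hθ : θ ^ 2 = c ^ 2 * ‖ξ‖ ^ 2 - μ ^ 2) (hθ0 : θ ≠ 0) (t : ℝ) :
    longitudinal ξ (u t) = Real.exp (-μ * t) *
      (longitudinal ξ (u 0) * (Real.cos (θ * t) - μ / θ * Real.sin (θ * t) : ℝ)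
        - Complex.I * (c * ‖ξ‖ ^ 2 / θ * Real.sin (θ * t) : ℝ) * u 0 none) := by
  have hμ' : (2 * μ : ℂ) = (a + b) * ‖ξ‖ ^ 2 := by exact_mod_cast hμ
  have hθ' : (θ : ℂ) ^ 2 = c ^ 2 * ‖ξ‖ ^ 2 - μ ^ 2 := by exact_mod_cast hθ
  have hθ0' : (θ : ℂ) ≠ 0 := by exact_mod_cast hθ0
  -- For a root `l` of the characteristic polynomial this combination of density and longitudinal
  -- part is a left eigenvector, so it evolves by `exp (l * s)`. The two conjugate roots `-μ ± iθ`
  -- then determine the longitudinal part.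
  have key : ∀ l : ℂ, l ^ 2 + 2 * μ * l + c ^ 2 * ‖ξ‖ ^ 2 = 0 → ∀ s : ℝ,
      -(Complex.I * c * ‖ξ‖ ^ 2) * u s none + l * longitudinal ξ (u s) =
        Complex.exp (l * s) * (-(Complex.I * c * ‖ξ‖ ^ 2) * u 0 none + l * longitudinal ξ (u 0)) := by
    intro l hl s
    have hd : ∀ r : ℝ, HasDerivAt (fun r : ℝ => Complex.exp (-l * r) *
        (-(Complex.I * c * ‖ξ‖ ^ 2) * u r none + l * longitudinal ξ (u r))) 0 r := by
      intro r
      have h1 : HasDerivAt (fun r : ℝ => Complex.exp (-l * r)) (Complex.exp (-l * r) * -l) r := by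
        have := (((hasDerivAt_id (r : ℂ)).const_mul (-l)).cexp).comp_ofReal
        simpa using this
      convert! h1.mul (((h.hasDerivAt_none r).const_mul (-(Complex.I * c * ‖ξ‖ ^ 2))).add
        ((h.hasDerivAt_longitudinal r).const_mul l)) using 1
      simp only [Pi.add_apply]
      linear_combination (Complex.exp (-l * r) * longitudinal ξ (u r)) * hl
        - (Complex.exp (-l * r) * longitudinal ξ (u r) * l) * hμ'
        - (Complex.exp (-l * r) * longitudinal ξ (u r) * c ^ 2 * ‖ξ‖ ^ 2) * Complex.I_sq
    have hconst := is_const_of_deriv_eq_zero (fun r => (hd r).differentiableAt)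
      (fun r => (hd r).deriv) s 0
    simp only [Complex.ofReal_zero, mul_zero, Complex.exp_zero, one_mul] at hconst
    rw [← hconst, ← mul_assoc, ← Complex.exp_add]
    simp
  have h1 := key (-μ + θ * Complex.I) (by
    linear_combination (θ : ℂ) ^ 2 * Complex.I_sq - hθ') t
  have h2 := key (-μ - θ * Complex.I) (by
    linear_combination (θ : ℂ) ^ 2 * Complex.I_sq - hθ') t
  have e1 : Complex.exp ((-μ + θ * Complex.I) * t) = Complex.exp (-μ * t) *
      (Complex.cos (θ * t) + Complex.sin (θ * t) * Complex.I) := by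
    rw [← Complex.exp_mul_I, ← Complex.exp_add]
    ring_nf
  have e2 : Complex.exp ((-μ - θ * Complex.I) * t) = Complex.exp (-μ * t) *
      (Complex.cos (θ * t) - Complex.sin (θ * t) * Complex.I) := by
    have := Complex.exp_mul_I (-(θ * t : ℂ))
    rw [Complex.cos_neg, Complex.sin_neg] at this
    rw [sub_eq_add_neg (Complex.cos _), ← neg_mul (Complex.sin _), ← this, ← Complex.exp_add]
    ring_nf
  rw [e1] at h1
  rw [e2] at h2
  have hne : (2 * θ * Complex.I : ℂ) ≠ 0 := by simp [hθ0, Complex.I_ne_zero]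
  refine mul_left_cancel₀ hne ?_
  push_cast
  set x := longitudinal ξ (u 0)
  set y := longitudinal ξ (u t)
  set S := Complex.sin (θ * t)
  set K := Complex.cos (θ * t)
  set X := Complex.exp (-μ * t)
  have h3 : 2 * θ * Complex.I * y = X * (x * (2 * θ * Complex.I * K - 2 * μ * Complex.I * S)
      + (-(Complex.I * c * ‖ξ‖ ^ 2) * u 0 none) * (2 * S * Complex.I)) := by
    linear_combination h1 - h2
  rw [h3]
  field_simp
  ring

end ModeODE

end LinearizedNS

/-! ### Plancherel, the Fourier integral of the data, and the upper bound -/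

namespace LinearizedNS

open scoped ContDiff Topology FourierTransform Real
open Filter Set

variable {n : ℕ} {α β γ : ℝ} {ρ₀ : Lp ℝ 2 (volume : Measure (E n))}
  {v₀ : Lp (E n) 2 (volume : Measure (E n))} {ρ : ℝ → Lp ℝ 2 (volume : Measure (E n))}
  {v : ℝ → Lp (E n) 2 (volume : Measure (E n))}

theorem norm_spec (f : Lp ℝ 2 (volume : Measure (E n))) : ‖spec f‖ = ‖f‖ := by
  rw [spec, Lp.norm_fourier_eq]
  refine (sq_eq_sq₀ (norm_nonneg _) (norm_nonneg _)).1 ?_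
  rw [← integral_norm_sq_eq, ← integral_norm_sq_eq]
  refine integral_congr_ae ?_
  filter_upwards [Complex.ofRealCLM.coeFn_compLp f] with x hx
  rw [hx, Complex.ofRealCLM_apply, Complex.norm_real]

theorem norm_sq_eq_sum_component (w : Lp (E n) 2 (volume : Measure (E n))) :
    ‖w‖ ^ 2 = ∑ j, ‖component j w‖ ^ 2 := by
  simp only [← integral_norm_sq_eq]
  rw [← integral_finsetSum _ fun j _ => integrable_norm_sq (component j w)]
  refine integral_congr_ae ?_
  filter_upwards [eventually_all.2 fun j => coeFn_component j w] with x hx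
  rw [EuclideanSpace.norm_sq_eq]
  exact Finset.sum_congr rfl fun j _ => by rw [hx j]

theorem integrable_kinetic_specState (r : Lp ℝ 2 (volume : Measure (E n)))
    (w : Lp (E n) 2 (volume : Measure (E n))) :
    Integrable fun ξ => kinetic fun i => specState r w i ξ :=
  integrable_finsetSum _ fun j _ => integrable_norm_sq (specState r w (some j))

/-- Plancherel's identity for the velocity. -/
theorem norm_sq_eq_integral_kinetic (r : Lp ℝ 2 (volume : Measure (E n)))
    (w : Lp (E n) 2 (volume : Measure (E n))) :
    ‖w‖ ^ 2 = ∫ ξ, kinetic fun i => specState r w i ξ := by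
  simp only [kinetic]
  rw [integral_finsetSum _ fun j _ => integrable_norm_sq (specState r w (some j)),
    norm_sq_eq_sum_component]
  refine Finset.sum_congr rfl fun j _ => ?_
  rw [integral_norm_sq_eq, specState, norm_spec]

theorem continuous_fourier_of_integrable {f : E n → ℝ} (hf : Integrable f) :
    Continuous (𝓕 fun x => (f x : ℂ)) :=
  VectorFourier.fourierIntegral_continuous Real.continuous_fourierChar
    (by exact continuous_inner) hf.ofReal

theorem norm_fourier_le_integral (f : E n → ℝ) (ξ : E n) :
    ‖𝓕 (fun x => (f x : ℂ)) ξ‖ ≤ ∫ x, |f x| := by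
  refine (VectorFourier.norm_fourierIntegral_le_integral_norm _ _ _ _ _).trans (le_of_eq ?_)
  simp

theorem fourier_zero_eq (f : E n → ℝ) : 𝓕 (fun x => (f x : ℂ)) 0 = ((∫ x, f x : ℝ) : ℂ) := by
  rw [Real.fourier_eq, ← integral_complex_ofReal]
  simp

/-- For integrable functions the `L²` Fourier transform is given by the Fourier integral. -/
theorem spec_ae_eq_fourier (f : Lp ℝ 2 (volume : Measure (E n))) (hf : Integrable f) :
    spec f =ᵐ[volume] 𝓕 fun x => (f x : ℂ) := by
  refine ae_eq_of_integral_contDiff_smul_eq (locallyIntegrable_lp_two _)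
    (continuous_fourier_of_integrable hf).locallyIntegrable fun g hg hgs => ?_
  have hgc : HasCompactSupport fun ξ => (g ξ : ℂ) := hgs.comp_left Complex.ofReal_zero
  set φ := hgc.toSchwartzMap (Complex.ofRealCLM.contDiff.comp hg) with hφ
  have h1 := pair_fourier f φ
  -- The Fourier integral obeys the same multiplication formula as the `L²` transform, so the two
  -- agree against every test function.
  have h2 := VectorFourier.integral_fourierIntegral_smul_eq_flip (L := innerₗ (E n))
    (μ := volume) (ν := volume) Real.continuous_fourierChar continuous_inner
    (hf.ofReal (𝕜 := ℂ)) φ.integrable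
  have h3 : pair f (𝓕 φ) = ∫ x, (f x : ℂ) •
      VectorFourier.fourierIntegral Real.fourierChar volume (innerₗ (E n)).flip φ x := by
    rw [flip_innerₗ]
    rfl
  calc ∫ ξ, g ξ • spec f ξ = ∫ ξ, spec f ξ * φ ξ := by
        congr 1; ext ξ; rw [Complex.real_smul, mul_comm]; rfl
    _ = ∫ ξ, VectorFourier.fourierIntegral Real.fourierChar volume (innerₗ (E n))
          (fun x => (f x : ℂ)) ξ • φ ξ := by rw [← h1, h3]; exact h2.symm
    _ = _ := by
        congr 1; ext ξ; rw [Complex.real_smul, smul_eq_mul, mul_comm]; rfl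

/-- The density and the velocity components, indexed together. -/
noncomputable def stateComponent (r : Lp ℝ 2 (volume : Measure (E n)))
    (w : Lp (E n) 2 (volume : Measure (E n))) : Option (Fin n) → Lp ℝ 2 (volume : Measure (E n))
  | none => r
  | some j => component j w

theorem specState_eq_spec (r : Lp ℝ 2 (volume : Measure (E n)))
    (w : Lp (E n) 2 (volume : Measure (E n))) (i : Option (Fin n)) :
    specState r w i = spec (stateComponent r w i) := by
  cases i <;> rfl

theorem integrable_stateComponent (hρ : MemL11 ρ₀) (hv : ∀ j, MemL11 fun x => v₀ x j)
    (i : Option (Fin n)) : Integrable (stateComponent ρ₀ v₀ i) := by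
  cases i with
  | none => exact hρ.1
  | some j => exact (hv j).1.congr (coeFn_component j v₀).symm

theorem MemL11.integral_abs_le {f : E n → ℝ} (hf : MemL11 f) : ∫ x, |f x| ≤ norm11 f := by
  refine integral_mono hf.1.abs hf.2 fun x => ?_
  nlinarith [norm_nonneg x, abs_nonneg (f x), mul_nonneg (norm_nonneg x) (abs_nonneg (f x))]

theorem norm11_nonneg (f : E n → ℝ) : 0 ≤ norm11 f :=
  integral_nonneg fun x => by positivity

theorem sum_integral_abs_le (hρ : MemL11 ρ₀) (hv : ∀ j, MemL11 fun x => v₀ x j) :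
    ∑ i, ∫ x, |stateComponent ρ₀ v₀ i x| ≤ ∑ j, norm11 (fun x => v₀ x j) + norm11 ρ₀ := by
  rw [Fintype.sum_option, add_comm]
  refine add_le_add (Finset.sum_le_sum fun j _ => ?_) hρ.integral_abs_le
  refine le_trans (le_of_eq ?_) (hv j).integral_abs_le
  refine integral_congr_ae ?_
  filter_upwards [coeFn_component j v₀] with x hx
  exact congrArg _ hx

theorem isMode_flow (a b c : ℝ) (ξ : E n) (u₀ : Option (Fin n) → ℂ) :
    IsMode a b c ξ fun s => flow (symbol a b c) s ξ u₀ :=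
  fun t => hasDerivAt_flow _ _ _ t

/-- A non-integrable function would have integral `0`, while the Gaussian integral is positive. -/
theorem integrable_exp_neg_mul_norm_sq {b : ℝ} (hb : 0 < b) :
    Integrable fun ξ : E n => Real.exp (-b * ‖ξ‖ ^ 2) := by
  by_contra h
  have h1 := GaussianFourier.integral_rexp_neg_mul_sq_norm (V := E n) hb
  rw [integral_undef h] at h1
  have : 0 < (π / b) ^ (Module.finrank ℝ (E n) / 2 : ℝ) := by positivity
  linarith

/-- Splits at `x = 1`: below it `x / (1 + x) ≥ x / 2`, giving a Gaussian times the sup bound `B`;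
above it `x / (1 + x) ≥ 1 / 2`, giving exponential decay times the integrable datum `A`. -/
theorem exp_decay_le {κ x t A B : ℝ} (hκ : 0 < κ) (hx : 0 ≤ x) (ht : 0 ≤ t) (hA : 0 ≤ A)
    (hAB : A ≤ B) :
    Real.exp (-(κ * (x / (1 + x))) * t) * A ≤
      Real.exp (-(κ * t / 2) * x) * B + Real.exp (-(κ * t / 2)) * A := by
  have hκt : 0 ≤ κ * t := by positivity
  have hB : 0 ≤ B := hA.trans hAB
  rcases le_total x 1 with h | h
  · have e : -(κ * (x / (1 + x))) * t ≤ -(κ * t / 2) * x := by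
      have : x / 2 ≤ x / (1 + x) := by gcongr; linarith
      nlinarith
    have := Real.exp_le_exp.2 e
    have h2 : Real.exp (-(κ * (x / (1 + x))) * t) * A ≤ Real.exp (-(κ * t / 2) * x) * B := by
      gcongr
    have h3 : 0 ≤ Real.exp (-(κ * t / 2)) * A := by positivity
    linarith
  · have e : -(κ * (x / (1 + x))) * t ≤ -(κ * t / 2) := by
      have : 1 / 2 ≤ x / (1 + x) := by
        rw [div_le_div_iff₀ (by norm_num) (by linarith)]; linarith
      nlinarith
    have h2 : Real.exp (-(κ * (x / (1 + x))) * t) * A ≤ Real.exp (-(κ * t / 2)) * A := by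
      gcongr
    have h3 : 0 ≤ Real.exp (-(κ * t / 2) * x) * B := by positivity
    linarith

/-- A single term of the exponential series beats `t ^ m`, which for `t ≥ 1` is more than the power
required. -/
theorem exp_neg_le_rpow {κ t : ℝ} (hκ : 0 < κ) (ht : 1 ≤ t) (m : ℕ) :
    Real.exp (-(κ * t / 2)) ≤ m.factorial * (2 / κ) ^ m * t ^ (-(m : ℝ) / 2) := by
  have hx : 0 < κ * t / 2 := by positivity
  have h1 := Real.pow_div_factorial_le_exp (κ * t / 2) hx.le m
  have h2 : Real.exp (-(κ * t / 2)) ≤ m.factorial * (2 / κ) ^ m * (t ^ m)⁻¹ := by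
    rw [Real.exp_neg]
    refine (inv_anti₀ (by positivity) h1).trans (le_of_eq ?_)
    rw [inv_div, div_pow, mul_pow, div_pow]
    field_simp
  refine h2.trans (mul_le_mul_of_nonneg_left ?_ (by positivity))
  rw [← Real.rpow_natCast, ← Real.rpow_neg (by linarith)]
  refine Real.rpow_le_rpow_of_exponent_le ht ?_
  have : (0 : ℝ) ≤ m := by positivity
  linarith

theorem exists_upper_bound (n : ℕ) (α β γ : ℝ) (hα : 0 < α) (hβ : 0 ≤ β) (hγ : 0 < γ) :
    ∃ C : ℝ, 0 < C ∧ ∀ (ρ₀ : Lp ℝ 2 (volume : Measure (E n)))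
      (v₀ : Lp (E n) 2 (volume : Measure (E n))),
      MemL11 ρ₀ → (∀ j, MemL11 (fun x => v₀ x j)) →
      ∀ (ρ : ℝ → Lp ℝ 2 (volume : Measure (E n))) (v : ℝ → Lp (E n) 2 (volume : Measure (E n))),
      IsSolution α β γ ρ₀ v₀ ρ v → ∀ t : ℝ, 1 ≤ t →
      ‖v t‖ ≤ C * (∑ j, norm11 (fun x => v₀ x j) + norm11 ρ₀ + ‖v₀‖ + ‖ρ₀‖)
        * t ^ (-(n : ℝ) / 4) := by
  obtain ⟨κ, hκ, hdecay⟩ := exists_energy_decay (n := n) (4 * π ^ 2 * α) (4 * π ^ 2 * β)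
    (2 * π * γ) (by positivity) (by positivity) (by positivity)
  set D : ℝ := 3 * ((2 * π / κ) ^ ((n : ℝ) / 2) + n.factorial * (2 / κ) ^ n) with hD
  have hD0 : 0 < D := by positivity
  refine ⟨√D, by positivity, fun ρ₀ v₀ hρ hv ρ v h t ht => ?_⟩
  have ht0 : 0 < t := by linarith
  set N : ℝ := ∑ j, norm11 (fun x => v₀ x j) + norm11 ρ₀ with hN
  have hN0 : 0 ≤ N := add_nonneg (Finset.sum_nonneg fun j _ => norm11_nonneg _) (norm11_nonneg _)
  set U₀ : E n → Option (Fin n) → ℂ := fun ξ i => specState ρ₀ v₀ i ξ with hU₀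
  set e₀ : E n → ℝ := fun ξ => ‖U₀ ξ none‖ ^ 2 + kinetic (U₀ ξ) with he₀
  have he₀0 : ∀ ξ, 0 ≤ e₀ ξ := fun ξ => add_nonneg (sq_nonneg _) (kinetic_nonneg _)
  have he₀N : ∀ᵐ ξ, e₀ ξ ≤ N ^ 2 := by
    filter_upwards [eventually_all.2 fun i => spec_ae_eq_fourier (stateComponent ρ₀ v₀ i)
      (integrable_stateComponent hρ hv i)] with ξ hξ
    have hb : ∀ i, ‖U₀ ξ i‖ ≤ ∫ x, |stateComponent ρ₀ v₀ i x| := fun i => by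
      rw [hU₀]
      simp only [specState_eq_spec, hξ i]
      exact norm_fourier_le_integral _ _
    have hs : e₀ ξ = ∑ i, ‖U₀ ξ i‖ ^ 2 := by rw [Fintype.sum_option]; rfl
    rw [hs]
    refine (Finset.sum_sq_le_sq_sum_of_nonneg fun i _ => norm_nonneg _).trans ?_
    have hle := (Finset.sum_le_sum fun i (_ : i ∈ Finset.univ) => hb i).trans
      (sum_integral_abs_le hρ hv)
    exact pow_le_pow_left₀ (Finset.sum_nonneg fun i _ => norm_nonneg _) hle 2
  have he₀i : Integrable e₀ :=
    (integrable_norm_sq (specState ρ₀ v₀ none)).add (integrable_kinetic_specState ρ₀ v₀)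
  have he₀I : ∫ ξ, e₀ ξ = ‖ρ₀‖ ^ 2 + ‖v₀‖ ^ 2 := by
    rw [integral_add (integrable_norm_sq (specState ρ₀ v₀ none))
      (integrable_kinetic_specState ρ₀ v₀), ← norm_sq_eq_integral_kinetic]
    change (∫ ξ, ‖spec ρ₀ ξ‖ ^ 2) + _ = _
    rw [integral_norm_sq_eq, norm_spec]
  have hb0 : 0 < κ * t / 2 := by positivity
  have i1 := (integrable_exp_neg_mul_norm_sq (n := n) hb0).mul_const (N ^ 2)
  have i2 := he₀i.const_mul (Real.exp (-(κ * t / 2)))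
  have hmain : ‖v t‖ ^ 2 ≤ D * (N + ‖v₀‖ + ‖ρ₀‖) ^ 2 * t ^ (-(n : ℝ) / 2) := by
    calc ‖v t‖ ^ 2 = ∫ ξ, kinetic fun i => specState (ρ t) (v t) i ξ :=
          norm_sq_eq_integral_kinetic _ _
      _ ≤ ∫ ξ, 3 * (Real.exp (-(κ * t / 2) * ‖ξ‖ ^ 2) * N ^ 2
            + Real.exp (-(κ * t / 2)) * e₀ ξ) := by
          refine integral_mono_ae (integrable_kinetic_specState _ _) ((i1.add i2).const_mul 3) ?_
          filter_upwards [h.specState_eq_flow ht0.le, he₀N] with ξ hξ hξN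
          have hd := hdecay ξ _ (isMode_flow _ _ _ ξ (U₀ ξ)) t ht0.le
          simp only [flow_zero] at hd
          have hk : (fun i => specState (ρ t) (v t) i ξ) = flow (symbol (4 * π ^ 2 * α)
              (4 * π ^ 2 * β) (2 * π * γ)) t ξ (U₀ ξ) := funext hξ
          rw [hk]
          have h3 := exp_decay_le hκ (sq_nonneg ‖ξ‖) ht0.le (he₀0 ξ) hξN
          have h4 := sq_nonneg ‖flow (symbol (4 * π ^ 2 * α)
              (4 * π ^ 2 * β) (2 * π * γ)) t ξ (U₀ ξ) none‖
          change _ ≤ 3 * _ * e₀ ξ at hd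
          linarith
      _ = 3 * ((π / (κ * t / 2)) ^ ((n : ℝ) / 2) * N ^ 2 + Real.exp (-(κ * t / 2)) *
            (‖ρ₀‖ ^ 2 + ‖v₀‖ ^ 2)) := by
          rw [integral_const_mul, integral_add i1 i2, integral_mul_const, integral_const_mul,
            GaussianFourier.integral_rexp_neg_mul_sq_norm hb0, he₀I, finrank_euclideanSpace_fin]
      _ ≤ 3 * ((2 * π / κ) ^ ((n : ℝ) / 2) * t ^ (-(n : ℝ) / 2) * (N + ‖v₀‖ + ‖ρ₀‖) ^ 2 +
            n.factorial * (2 / κ) ^ n * t ^ (-(n : ℝ) / 2) * (N + ‖v₀‖ + ‖ρ₀‖) ^ 2) := by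
          have e1 : (π / (κ * t / 2)) ^ ((n : ℝ) / 2)
              = (2 * π / κ) ^ ((n : ℝ) / 2) * t ^ (-(n : ℝ) / 2) := by
            have : π / (κ * t / 2) = 2 * π / κ * t⁻¹ := by field_simp
            rw [this, Real.mul_rpow (by positivity) (by positivity),
              Real.inv_rpow ht0.le, ← Real.rpow_neg ht0.le, neg_div]
          have e2 := exp_neg_le_rpow hκ ht n
          have hv0 := norm_nonneg v₀
          have hr0 := norm_nonneg ρ₀
          rw [e1]
          gcongr
          · linarith
          · nlinarith [mul_nonneg hN0 hv0, mul_nonneg hN0 hr0, mul_nonneg hv0 hr0]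
      _ = _ := by rw [hD]; ring
  refine abs_le_of_sq_le_sq' ?_ (by positivity) |>.2
  refine hmain.trans (le_of_eq ?_)
  rw [mul_pow, mul_pow, Real.sq_sqrt hD0.le, ← Real.rpow_natCast (t ^ _), ← Real.rpow_mul ht0.le]
  congr 2
  push_cast
  ring

end LinearizedNS

/-! ### Oscillation of low frequency modes from below -/

namespace LinearizedNS

open scoped Topology FourierTransform Real
open Filter Set

variable {n : ℕ}

theorem abs_im_longitudinal_le (ξ : E n) (u : Option (Fin n) → ℂ) :
    |(longitudinal ξ u).im| ≤ ‖ξ‖ * ∑ k, |(u (some k)).im| := by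
  have e : (longitudinal ξ u).im = ∑ k, ξ k * (u (some k)).im := by
    simp [longitudinal, Complex.im_sum]
  rw [e, Finset.mul_sum]
  refine (Finset.abs_sum_le_sum_abs _ _).trans (Finset.sum_le_sum fun k _ => ?_)
  rw [abs_mul]
  exact mul_le_mul_of_nonneg_right (by simpa using PiLp.norm_apply_le ξ k) (abs_nonneg _)

/-- The frequency of oscillation of a low frequency mode. -/
theorem exists_frequency {c r μ : ℝ} (hc : 0 < c) (hr : 0 < r) (hμ0 : 0 ≤ μ)
    (hμ : μ ≤ c * r / 2) :
    ∃ θ, 0 < θ ∧ θ ^ 2 = c ^ 2 * r ^ 2 - μ ^ 2 ∧ μ ≤ θ ∧ θ ≤ c * r ∧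
      c * r - θ ≤ μ ^ 2 / (c * r) := by
  have hcr : 0 < c * r := by positivity
  have hsq : 0 ≤ c ^ 2 * r ^ 2 - μ ^ 2 := by nlinarith
  have hθsq := Real.sq_sqrt hsq
  have hθnn := Real.sqrt_nonneg (c ^ 2 * r ^ 2 - μ ^ 2)
  set θ := √(c ^ 2 * r ^ 2 - μ ^ 2) with hθ
  have hθlow : c * r / 2 ≤ θ := by
    refine Real.le_sqrt_of_sq_le ?_
    nlinarith
  have hθup : θ ≤ c * r := by
    refine Real.sqrt_le_iff.2 ⟨hcr.le, ?_⟩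
    nlinarith [sq_nonneg μ]
  refine ⟨θ, by linarith, hθsq, by linarith, hθup, ?_⟩
  rw [le_div_iff₀ hcr]
  nlinarith

theorem abs_sin_sub_le_abs_sin {x y d : ℝ} (h : |x - y| ≤ d) :
    |Real.sin x| - d ≤ |Real.sin y| := by
  have e1 : |Real.sin x - Real.sin y| ≤ |x - y| := Real.abs_sin_sub_sin_le _ _
  have e2 := abs_sub_abs_le_abs_sub (Real.sin x) (Real.sin y)
  linarith

/-- A lower bound for the amplitude `p (C - κ S) - c r² / θ S x` of an oscillation, where `S` and
`C` are bounded by one, `p` is small and `x` is close to `Q`. -/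
theorem amplitude_ge {c r θ κ p x C S Q ε : ℝ} (hr : 0 < r) (hθ : 0 < θ) (hθc : θ ≤ c * r)
    (hκ0 : 0 ≤ κ) (hκ : κ ≤ 1) (hp : |p| ≤ r * ε) (hx : |x - Q| ≤ ε) (hC : |C| ≤ 1)
    (hS : |S| ≤ 1) :
    r * (|Q| * |S| - 3 * ε) ≤ |p * (C - κ * S) - c * r ^ 2 / θ * S * x| := by
  have hε0 : 0 ≤ ε := (abs_nonneg _).trans hx
  have h1 : |p * (C - κ * S)| ≤ r * (2 * ε) := by
    have e4 : |κ * S| ≤ 1 := by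
      rw [abs_mul, abs_of_nonneg hκ0]
      exact mul_le_one₀ hκ (abs_nonneg _) hS
    have e2 : |C - κ * S| ≤ 2 := (abs_sub _ _).trans (by linarith)
    rw [abs_mul]
    calc _ ≤ (r * ε) * 2 := mul_le_mul hp e2 (abs_nonneg _) (by positivity)
      _ = _ := by ring
  have h2 : r * (|Q| * |S| - ε) ≤ |c * r ^ 2 / θ * S * x| := by
    have e1 : |Q| - ε ≤ |x| := by
      have := abs_sub_abs_le_abs_sub Q x
      rw [abs_sub_comm] at this
      linarith
    have e2 : r ≤ c * r ^ 2 / θ := by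
      rw [le_div_iff₀ hθ]; nlinarith
    rw [abs_mul, abs_mul, abs_of_nonneg (hr.le.trans e2)]
    have e3 : |Q| * |S| - ε ≤ |S| * |x| := by
      have := mul_le_mul_of_nonneg_left e1 (abs_nonneg S)
      nlinarith [abs_nonneg S]
    calc _ ≤ r * (|S| * |x|) := mul_le_mul_of_nonneg_left e3 hr.le
      _ ≤ c * r ^ 2 / θ * (|S| * |x|) := by gcongr
      _ = _ := by ring
  have e3 := abs_sub_abs_le_abs_sub (c * r ^ 2 / θ * S * x) (p * (C - κ * S))
  rw [abs_sub_comm] at e3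
  linarith

/-- Squares `y * A ≤ √k + y * η` by means of `(p + q) ^ 2 ≤ 2 * p ^ 2 + 2 * q ^ 2`. When `A ≤ η`
that inequality is trivial, so the sign of `A - η` does not matter. -/
theorem sq_mul_half_sub_le {y z A η k : ℝ} (hy : 0 ≤ y) (hyz : y ≤ z) (hA : 0 ≤ A)
    (hk : 0 ≤ k) (h : z * (A - η) ≤ √k) : y ^ 2 * (A ^ 2 / 2 - η ^ 2) ≤ k := by
  have h6 : y * A ≤ √k + y * η := by
    rcases le_total A η with hle | hle
    · have := mul_le_mul_of_nonneg_left hle hy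
      linarith [Real.sqrt_nonneg k]
    · have := mul_le_mul_of_nonneg_right hyz (sub_nonneg.2 hle)
      linarith
  have h7 : (y * A) ^ 2 ≤ (√k + y * η) ^ 2 := pow_le_pow_left₀ (by positivity) h6 2
  nlinarith [Real.sq_sqrt hk, sq_nonneg (√k - y * η)]

/-- A low frequency mode whose density is close to the real number `Q`, and whose velocity is
nearly real, oscillates with amplitude at least comparable to `|Q|`. -/
theorem IsMode.kinetic_ge {a b c : ℝ} {ξ : E n} {u : ℝ → Option (Fin n) → ℂ}
    (h : IsMode a b c ξ u) (hab : 0 < a + b) (hc : 0 < c) (hξ : 0 < ‖ξ‖)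
    (hsmall : (a + b) * ‖ξ‖ ≤ c) {t : ℝ} (ht : 0 ≤ t) (htξ : ‖ξ‖ ^ 2 * t ≤ 4) {Q ε η : ℝ}
    (hQ : |(u 0 none).re - Q| ≤ ε) (hP : ∑ k, |(u 0 (some k)).im| ≤ ε)
    (hη : |Q| * ((a + b) ^ 2 * ‖ξ‖ ^ 3 * t / (4 * c)) + 3 * ε ≤ η) :
    Real.exp (-(4 * (a + b))) * (Q ^ 2 * Real.sin (c * t * ‖ξ‖) ^ 2 / 2 - η ^ 2) ≤
      kinetic (u t) := by
  have hε0 : 0 ≤ ε := (abs_nonneg _).trans hQ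
  obtain ⟨μ, hμ⟩ : ∃ μ, μ = (a + b) * ‖ξ‖ ^ 2 / 2 := ⟨_, rfl⟩
  have hμ0 : 0 ≤ μ := by rw [hμ]; positivity
  have hμc : μ ≤ c * ‖ξ‖ / 2 := by rw [hμ]; nlinarith
  obtain ⟨θ, hθ0, hθsq, hμθ, hθc, hθd⟩ := exists_frequency hc hξ hμ0 hμc
  have hlong := h.longitudinal_eq (μ := μ) (θ := θ) (by rw [hμ]; ring) hθsq hθ0.ne' t
  -- The imaginary part sees the real part of the density, which is close to `Q`, and only the
  -- imaginary part of the velocity, which is small.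
  have him : (longitudinal ξ (u t)).im = Real.exp (-μ * t) *
      ((longitudinal ξ (u 0)).im * (Real.cos (θ * t) - μ / θ * Real.sin (θ * t))
        - c * ‖ξ‖ ^ 2 / θ * Real.sin (θ * t) * (u 0 none).re) := by
    rw [hlong, Complex.im_ofReal_mul, Complex.sub_im, Complex.im_mul_ofReal, mul_assoc Complex.I,
      Complex.I_mul_im, Complex.re_ofReal_mul]
  have hamp := amplitude_ge (c := c) hξ hθ0 hθc (div_nonneg hμ0 hθ0.le) ((div_le_one hθ0).2 hμθ)
    ((abs_im_longitudinal_le ξ (u 0)).trans (mul_le_mul_of_nonneg_left hP hξ.le)) hQ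
    (Real.abs_cos_le_one (θ * t)) (Real.abs_sin_le_one (θ * t))
  -- Replacing `θ` by `c * ‖ξ‖` costs a phase error of at most `μ ^ 2 * t / (c * ‖ξ‖)`.
  have hsin : |Real.sin (c * t * ‖ξ‖)| - (a + b) ^ 2 * ‖ξ‖ ^ 3 * t / (4 * c)
      ≤ |Real.sin (θ * t)| := by
    refine abs_sin_sub_le_abs_sin ?_
    have e2 : |c * t * ‖ξ‖ - θ * t| = (c * ‖ξ‖ - θ) * t := by
      rw [← abs_of_nonneg (mul_nonneg (sub_nonneg.2 hθc) ht)]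
      congr 1
      ring
    rw [e2]
    refine (mul_le_mul_of_nonneg_right hθd ht).trans (le_of_eq ?_)
    rw [hμ]
    field_simp
    ring
  have hQsin := mul_le_mul_of_nonneg_left hsin (abs_nonneg Q)
  have h4 : ‖ξ‖ * (Real.exp (-μ * t) * (|Q| * |Real.sin (c * t * ‖ξ‖)| - η)) ≤
      ‖longitudinal ξ (u t)‖ := by
    have e4 : |Q| * |Real.sin (c * t * ‖ξ‖)| - η ≤ |Q| * |Real.sin (θ * t)| - 3 * ε := by
      linarith
    have e5 := (mul_le_mul_of_nonneg_left e4 hξ.le).trans hamp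
    refine le_trans ?_ (Complex.abs_im_le_norm _)
    rw [him, abs_mul, abs_of_pos (Real.exp_pos _), mul_left_comm]
    exact mul_le_mul_of_nonneg_left e5 (Real.exp_pos _).le
  have h5 : Real.exp (-μ * t) * (|Q| * |Real.sin (c * t * ‖ξ‖)| - η) ≤ √(kinetic (u t)) := by
    refine le_of_mul_le_mul_left (h4.trans ?_) hξ
    refine abs_le_of_sq_le_sq' ?_ (by positivity) |>.2
    rw [mul_pow, Real.sq_sqrt (kinetic_nonneg _)]
    exact norm_longitudinal_sq_le ξ (u t)
  have hexp : Real.exp (-(2 * (a + b))) ≤ Real.exp (-μ * t) := by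
    refine Real.exp_le_exp.2 ?_
    have := mul_le_mul_of_nonneg_left htξ hab.le
    rw [hμ]
    linarith
  have hfin := sq_mul_half_sub_le (Real.exp_pos _).le hexp (by positivity)
    (kinetic_nonneg (u t)) h5
  rw [mul_pow, sq_abs, sq_abs, ← Real.exp_nat_mul] at hfin
  convert! hfin using 3
  push_cast
  ring

/-! ### Integrals of the squared sine over an annulus -/

/-- The annulus `r ≤ |ξ| ≤ 2 r`. -/
def annulus (n : ℕ) (r : ℝ) : Set (E n) := {ξ | ‖ξ‖ ∈ Icc r (2 * r)}

theorem measurableSet_annulus (r : ℝ) : MeasurableSet (annulus n r) :=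
  measurableSet_Icc.preimage measurable_norm

theorem annulus_subset (r : ℝ) : annulus n r ⊆ Metric.closedBall 0 (2 * r) := fun ξ hξ => by
  rw [mem_closedBall_zero_iff]
  exact hξ.2

theorem measureReal_annulus_le {r : ℝ} (hr : 0 ≤ r) : volume.real (annulus n r) ≤
    (2 * r) ^ n * volume.real (Metric.ball (0 : E n) 1) := by
  refine (measureReal_mono (annulus_subset r) measure_closedBall_lt_top.ne).trans (le_of_eq ?_)
  have := Measure.addHaar_real_closedBall (volume : Measure (E n)) 0 (r := 2 * r) (by linarith)
  rwa [finrank_euclideanSpace_fin] at this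

/-- The mean value of the squared sine contributes `r / 2`, and the boundary terms are at most `1 /
(2 * k) ≤ r / 4`. -/
theorem integral_sin_sq_ge {k r : ℝ} (hr : 0 < r) (hkr : 2 ≤ k * r) :
    r / 4 ≤ ∫ y in Icc r (2 * r), Real.sin (k * y) ^ 2 := by
  have hk : 0 < k := by
    by_contra h
    nlinarith
  have hd : ∀ y : ℝ, HasDerivAt (fun y => y / 2 - Real.sin (2 * k * y) / (4 * k))
      (Real.sin (k * y) ^ 2) y := by
    intro y
    have h1 : HasDerivAt (fun y => Real.sin (2 * k * y)) (Real.cos (2 * k * y) * (2 * k)) y := by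
      simpa using ((hasDerivAt_id y).const_mul (2 * k)).sin
    convert! ((hasDerivAt_id y).div_const 2).sub (h1.div_const (4 * k)) using 1
    rw [mul_assoc 2 k y, Real.cos_two_mul, Real.cos_sq']
    field_simp
    ring
  rw [integral_Icc_eq_integral_Ioc, ← intervalIntegral.integral_of_le (by linarith),
    intervalIntegral.integral_eq_sub_of_hasDerivAt (fun y _ => hd y)
      ((by fun_prop : Continuous fun y => Real.sin (k * y) ^ 2).intervalIntegrable _ _)]
  have e1 : (Real.sin (2 * k * (2 * r)) - Real.sin (2 * k * r)) / (4 * k) ≤ r / 4 := by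
    rw [div_le_div_iff₀ (by positivity) (by norm_num)]
    have := Real.sin_le_one (2 * k * (2 * r))
    have := Real.neg_one_le_sin (2 * k * r)
    nlinarith
  rw [sub_div] at e1
  linarith

/-- Polar coordinates, with the Jacobian `y ^ (n - 1)` bounded below by `r ^ (n - 1)`. -/
theorem setIntegral_sin_sq_norm_ge (hn : 1 ≤ n) {k r : ℝ} (hr : 0 < r) (hkr : 2 ≤ k * r) :
    n * volume.real (Metric.ball (0 : E n) 1) * r ^ n / 4 ≤
      ∫ ξ in annulus n r, Real.sin (k * ‖ξ‖) ^ 2 := by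
  have : Nontrivial (E n) := by
    have : Nonempty (Fin n) := ⟨⟨0, hn⟩⟩
    infer_instance
  have h1 : ∫ ξ in annulus n r, Real.sin (k * ‖ξ‖) ^ 2
      = ∫ ξ : E n, (Icc r (2 * r)).indicator (fun y => Real.sin (k * y) ^ 2) ‖ξ‖ := by
    rw [← integral_indicator (measurableSet_annulus r)]
    rfl
  rw [h1, integral_fun_norm_addHaar, finrank_euclideanSpace_fin]
  have h2 : ∫ y in Ioi (0 : ℝ), y ^ (n - 1) • (Icc r (2 * r)).indicator
      (fun y => Real.sin (k * y) ^ 2) y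
      = ∫ y in Icc r (2 * r), y ^ (n - 1) * Real.sin (k * y) ^ 2 := by
    have e : (fun y : ℝ => y ^ (n - 1) • (Icc r (2 * r)).indicator
        (fun y => Real.sin (k * y) ^ 2) y) =
        (Icc r (2 * r)).indicator fun y => y ^ (n - 1) * Real.sin (k * y) ^ 2 := by
      ext y
      by_cases hy : y ∈ Icc r (2 * r) <;> simp [hy]
    rw [e, setIntegral_indicator measurableSet_Icc]
    congr 2
    exact inter_eq_right.2 fun y hy => hr.trans_le hy.1
  rw [h2]
  have h3 : r ^ (n - 1) * (r / 4) ≤ ∫ y in Icc r (2 * r), y ^ (n - 1) * Real.sin (k * y) ^ 2 := by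
    refine (mul_le_mul_of_nonneg_left (integral_sin_sq_ge hr hkr) (by positivity)).trans ?_
    rw [← integral_const_mul]
    refine setIntegral_mono_on ?_ ?_ measurableSet_Icc fun y hy => ?_
    · exact (Continuous.continuousOn (by fun_prop)).integrableOn_Icc
    · exact (Continuous.continuousOn (by fun_prop)).integrableOn_Icc
    · have := hy.1
      gcongr
  have h4 : r ^ n = r ^ (n - 1) * r := by rw [← pow_succ, Nat.sub_add_cancel hn]
  rw [nsmul_eq_mul, smul_eq_mul, h4]
  have h5 : 0 ≤ n * volume.real (Metric.ball (0 : E n) 1) := by positivity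
  have := mul_le_mul_of_nonneg_left h3 h5
  linarith

end LinearizedNS

/-! ### The lower bound for solutions -/

namespace LinearizedNS

open scoped Topology FourierTransform Real
open Filter Set

variable {n : ℕ} {α β γ : ℝ} {ρ₀ : Lp ℝ 2 (volume : Measure (E n))}
  {v₀ : Lp (E n) 2 (volume : Measure (E n))} {ρ : ℝ → Lp ℝ 2 (volume : Measure (E n))}
  {v : ℝ → Lp (E n) 2 (volume : Measure (E n))}

/-- The Fourier integrals are continuous, and at the origin they equal the real numbers `∫ ρ₀` and
the components of the momentum. -/
theorem exists_fourier_close (hρ : Integrable ρ₀) (hv : ∀ j, Integrable (component j v₀)) {ε : ℝ}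
    (hε : 0 < ε) : ∃ δ > 0, ∀ᵐ ξ : E n, ‖ξ‖ < δ →
      |(specState ρ₀ v₀ none ξ).re - ∫ x, ρ₀ x| ≤ ε ∧
        ∑ k, |(specState ρ₀ v₀ (some k) ξ).im| ≤ ε := by
  have h1 : ∀ᶠ ξ in 𝓝 (0 : E n), |(𝓕 (fun x => (ρ₀ x : ℂ)) ξ).re - ∫ x, ρ₀ x| < ε := by
    have hc : Continuous fun ξ : E n => |(𝓕 (fun x => (ρ₀ x : ℂ)) ξ).re - ∫ x, ρ₀ x| :=
      ((Complex.continuous_re.comp (continuous_fourier_of_integrable hρ)).sub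
        continuous_const).abs
    refine hc.continuousAt.eventually_lt continuousAt_const ?_
    rw [fourier_zero_eq, Complex.ofReal_re, sub_self, abs_zero]
    exact hε
  have h2 : ∀ᶠ ξ in 𝓝 (0 : E n),
      ∑ k, |(𝓕 (fun x => (component k v₀ x : ℂ)) ξ).im| < ε := by
    have hc : Continuous fun ξ : E n => ∑ k, |(𝓕 (fun x => (component k v₀ x : ℂ)) ξ).im| :=
      continuous_finsetSum _ fun k _ =>
        (Complex.continuous_im.comp (continuous_fourier_of_integrable (hv k))).abs
    refine hc.continuousAt.eventually_lt continuousAt_const ?_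
    simpa only [fourier_zero_eq, Complex.ofReal_im, abs_zero, Finset.sum_const_zero] using hε
  obtain ⟨δ, hδ, hball⟩ := Metric.eventually_nhds_iff.1 (h1.and h2)
  refine ⟨δ, hδ, ?_⟩
  filter_upwards [spec_ae_eq_fourier ρ₀ hρ,
    eventually_all.2 fun k => spec_ae_eq_fourier (component k v₀) (hv k)] with ξ hξ hξ' hlt
  have := hball (y := ξ) (by simpa using hlt)
  simp only [specState, hξ, hξ']
  exact ⟨this.1.le, this.2.le⟩

/-- If the total mass does not vanish, the `L²` norm of the velocity decays at most like
`t ^ (-n / 4)`, with a constant that does not depend on the sound speed. -/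
theorem IsSolution.eventually_norm_sq_ge (h : IsSolution α β γ ρ₀ v₀ ρ v) (hn : 1 ≤ n) (hα : 0 < α)
    (hβ : 0 ≤ β) (hγ : 0 < γ) (hρ : Integrable ρ₀) (hv : ∀ j, Integrable (component j v₀))
    (hQ : ∫ x, ρ₀ x ≠ 0) :
    ∀ᶠ t in atTop, Real.exp (-(4 * (4 * π ^ 2 * α + 4 * π ^ 2 * β))) *
      (n * volume.real (Metric.ball (0 : E n) 1) / 16) * (∫ x, ρ₀ x) ^ 2 * t ^ (-(n : ℝ) / 2)
      ≤ ‖v t‖ ^ 2 := by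
  set a := 4 * π ^ 2 * α with ha
  set b := 4 * π ^ 2 * β with hb
  set c := 2 * π * γ with hc
  have hab : 0 < a + b := by positivity
  have hc0 : 0 < c := by positivity
  set Q := ∫ x, ρ₀ x with hQdef
  set ω := volume.real (Metric.ball (0 : E n) 1) with hω
  have hn0 : (0 : ℝ) < n := by exact_mod_cast hn
  -- Chosen so that the error `η ^ 2 * (2 * r) ^ n` is exactly half of the main term `Q ^ 2 * n * r
  -- ^ n / 8`.
  set η := |Q| * √(n / (16 * 2 ^ n)) with hη
  have hη0 : 0 < η := by
    have := abs_pos.2 hQ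
    positivity
  have hη2 : η ^ 2 * 2 ^ n = Q ^ 2 * n / 16 := by
    rw [hη, mul_pow, sq_abs, Real.sq_sqrt (by positivity)]
    field_simp
  obtain ⟨δ, hδ, hclose⟩ := exists_fourier_close (n := n) hρ hv (ε := η / 6) (by positivity)
  have hlim : Tendsto (fun t : ℝ => (√t)⁻¹) atTop (𝓝 0) :=
    tendsto_inv_atTop_zero.comp Real.tendsto_sqrt_atTop
  have hsmall : ∀ (k : ℝ) {d : ℝ}, 0 < d → ∀ᶠ t : ℝ in atTop, k * (√t)⁻¹ < d := by
    intro k d hd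
    have := hlim.const_mul k
    rw [mul_zero] at this
    exact this.eventually_lt_const hd
  -- In order, the conditions on `r = (√t)⁻¹` ensure: closeness of the data to their values at the
  -- origin, the oscillatory regime, a small phase error, and enough oscillations across the
  -- annulus.
  filter_upwards [eventually_gt_atTop 0, hsmall 2 hδ, hsmall (2 * (a + b)) hc0,
    hsmall (|Q| * (2 * (a + b) ^ 2 / c)) (by positivity : 0 < η / 2), hsmall 2 hc0]
    with t ht h1 h2 h3 h4
  set r := (√t)⁻¹ with hr
  have hst : 0 < √t := Real.sqrt_pos.2 ht
  have hr0 : 0 < r := by positivity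
  have hr2 : r ^ 2 * t = 1 := by
    rw [hr, inv_pow, Real.sq_sqrt ht.le, inv_mul_cancel₀ ht.ne']
  have hkr : 2 ≤ c * t * r := by
    have e : 2 * r * (r * t) ≤ c * (r * t) := mul_le_mul_of_nonneg_right h4.le (by positivity)
    nlinarith
  have hrn : r ^ n = t ^ (-(n : ℝ) / 2) := by
    rw [hr, inv_pow, Real.sqrt_eq_rpow, ← Real.rpow_natCast, ← Real.rpow_mul ht.le,
      ← Real.rpow_neg ht.le]
    congr 1
    ring
  set y := Real.exp (-(4 * (a + b))) with hy
  have hy0 : 0 < y := Real.exp_pos _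
  have hfin : volume (annulus n r) ≠ ⊤ :=
    measure_ne_top_of_subset (annulus_subset r) measure_closedBall_lt_top.ne
  have i1 : IntegrableOn (fun ξ : E n => Real.sin (c * t * ‖ξ‖) ^ 2) (annulus n r) :=
    ((Continuous.continuousOn (by fun_prop)).integrableOn_compact
      (isCompact_closedBall (0 : E n) (2 * r))).mono_set (annulus_subset r)
  have i2 : IntegrableOn (fun _ : E n => y * η ^ 2) (annulus n r) := integrableOn_const hfin
  have hpt : ∀ᵐ ξ ∂(volume.restrict (annulus n r)),
      y * Q ^ 2 / 2 * Real.sin (c * t * ‖ξ‖) ^ 2 - y * η ^ 2 ≤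
        kinetic fun i => specState (ρ t) (v t) i ξ := by
    rw [ae_restrict_iff' (measurableSet_annulus r)]
    filter_upwards [hclose, h.specState_eq_flow ht.le] with ξ hξ hflow hmem
    have hξ0 : 0 < ‖ξ‖ := hr0.trans_le hmem.1
    have hξ2 : ‖ξ‖ ≤ 2 * r := hmem.2
    obtain ⟨hre, him⟩ := hξ (hξ2.trans_lt h1)
    have hk : (fun i => specState (ρ t) (v t) i ξ) = flow (symbol a b c) t ξ
        (fun l => specState ρ₀ v₀ l ξ) := funext hflow
    rw [hk]
    have hmode := isMode_flow a b c ξ (fun l => specState ρ₀ v₀ l ξ)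
    have hξt : ‖ξ‖ ^ 2 * t ≤ 4 := by
      have : ‖ξ‖ ^ 2 ≤ (2 * r) ^ 2 := pow_le_pow_left₀ hξ0.le hξ2 2
      have := mul_le_mul_of_nonneg_right this ht.le
      linarith
    -- The budget `η` is shared equally: `3 * (η / 6)` for the data and `η / 2` for the phase error.
    have hge := hmode.kinetic_ge hab hc0 hξ0 (by nlinarith) ht.le hξt (Q := Q) (ε := η / 6)
      (η := η) (by simpa only [flow_zero] using hre) (by simpa only [flow_zero] using him) (by
        have e1 : (a + b) ^ 2 * ‖ξ‖ ^ 3 * t / (4 * c) ≤ 2 * (a + b) ^ 2 / c * r := by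
          rw [div_mul_eq_mul_div, div_le_div_iff₀ (by positivity) hc0]
          have e2 : ‖ξ‖ ^ 3 * t ≤ 8 * r := by
            have : ‖ξ‖ ^ 2 * t * ‖ξ‖ ≤ 4 * (2 * r) := mul_le_mul hξt hξ2 hξ0.le (by norm_num)
            linarith
          have := mul_le_mul_of_nonneg_left e2 (by positivity : 0 ≤ (a + b) ^ 2 * c)
          linarith
        have e3 := mul_le_mul_of_nonneg_left e1 (abs_nonneg Q)
        linarith)
    linarith
  have hI := setIntegral_sin_sq_norm_ge hn hr0 hkr
  have hV := measureReal_annulus_le (n := n) hr0.le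
  calc y * (n * ω / 16) * Q ^ 2 * t ^ (-(n : ℝ) / 2)
      = y * Q ^ 2 / 2 * (n * ω * r ^ n / 4) - y * η ^ 2 * ((2 * r) ^ n * ω) := by
        rw [← hrn, mul_pow]
        linear_combination (y * r ^ n * ω) * hη2
    _ ≤ y * Q ^ 2 / 2 * (∫ ξ in annulus n r, Real.sin (c * t * ‖ξ‖) ^ 2)
        - y * η ^ 2 * volume.real (annulus n r) := by gcongr
    _ = ∫ ξ in annulus n r, (y * Q ^ 2 / 2 * Real.sin (c * t * ‖ξ‖) ^ 2 - y * η ^ 2) := by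
        rw [integral_sub (i1.const_mul _) i2, integral_const_mul, setIntegral_const, smul_eq_mul,
          mul_comm (volume.real _)]
    _ ≤ ∫ ξ in annulus n r, kinetic fun i => specState (ρ t) (v t) i ξ :=
        integral_mono_ae ((i1.const_mul _).sub i2)
          (integrable_kinetic_specState _ _).integrableOn hpt
    _ ≤ ∫ ξ, kinetic fun i => specState (ρ t) (v t) i ξ :=
        setIntegral_le_integral (integrable_kinetic_specState _ _)
          (.of_forall fun ξ => kinetic_nonneg _)
    _ = ‖v t‖ ^ 2 := (norm_sq_eq_integral_kinetic _ _).symm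

end LinearizedNS

/-! ### Choice of the constants -/

theorem theorem1p3 (n : ℕ) (hn : 2 ≤ n) (α β : ℝ) (hα : 0 < α) (hβ : 0 ≤ β) :
    ∃ C₁ : ℝ, 0 < C₁ ∧ ∃ K : ℝ, 0 < K ∧ ∀ γ : ℝ, 0 < γ →
      ∃ C₂ : ℝ, 0 < C₂ ∧ ∃ T₂ : ℝ, 0 < T₂ ∧
        ∀ (ρ₀ : Lp ℝ 2 (volume : Measure (LinearizedNS.E n)))
          (v₀ : Lp (LinearizedNS.E n) 2 (volume : Measure (LinearizedNS.E n))),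
          LinearizedNS.MemL11 ρ₀ → (∀ j, LinearizedNS.MemL11 (fun x => v₀ x j)) →
          ∀ (ρ : ℝ → Lp ℝ 2 (volume : Measure (LinearizedNS.E n)))
            (v : ℝ → Lp (LinearizedNS.E n) 2 (volume : Measure (LinearizedNS.E n))),
            LinearizedNS.IsSolution α β γ ρ₀ v₀ ρ v →
            (∀ t : ℝ, T₂ ≤ t →
              ‖v t‖ ≤ C₂ * (‖LinearizedNS.moment v₀‖ + |∫ x, ρ₀ x|
                  + ∑ j, LinearizedNS.norm11 (fun x => v₀ x j) + LinearizedNS.norm11 ρ₀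
                  + ‖v₀‖ + ‖ρ₀‖) * t ^ (-(n : ℝ) / 4)) ∧
            ((∫ x, ρ₀ x) ≠ 0 →
              ‖LinearizedNS.moment v₀‖ / |∫ x, ρ₀ x| < 1 / (1 + K) →
              ∃ T₁ : ℝ, 0 < T₁ ∧ ∀ t : ℝ, T₁ ≤ t →
                C₁ * (‖LinearizedNS.moment v₀‖ + |∫ x, ρ₀ x|) * t ^ (-(n : ℝ) / 4) ≤ ‖v t‖) := by
  have hn1 : 1 ≤ n := by omega
  have hn0 : (0 : ℝ) < n := by exact_mod_cast hn1
  obtain ⟨D, hD⟩ : ∃ D : ℝ, D = Real.exp (-(4 * (4 * Real.pi ^ 2 * α + 4 * Real.pi ^ 2 * β))) *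
      (n * volume.real (Metric.ball (0 : LinearizedNS.E n) 1) / 16) := ⟨_, rfl⟩
  have hω : 0 < volume.real (Metric.ball (0 : LinearizedNS.E n) 1) :=
    ENNReal.toReal_pos (Metric.measure_ball_pos _ _ one_pos).ne' measure_ball_lt_top.ne
  have hD0 : 0 < D := by rw [hD]; positivity
  -- With `K = 1` the hypothesis of the second part gives `|P₀| ≤ |Q₀|`, so `|P₀| + |Q₀| ≤ 2 *
  -- |Q₀|`; this is the factor `1 / 2`. Both constants are fixed before `γ`, as `D` does not involve
  -- it.
  refine ⟨√D / 2, by positivity, 1, one_pos, fun γ hγ => ?_⟩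
  obtain ⟨C₂, hC₂, hup⟩ := LinearizedNS.exists_upper_bound n α β γ hα hβ hγ
  refine ⟨C₂, hC₂, 1, one_pos, fun ρ₀ v₀ hρ hv ρ v h => ⟨fun t ht => ?_, fun hQ hPQ => ?_⟩⟩
  · refine (hup ρ₀ v₀ hρ hv ρ v h t ht).trans ?_
    have ht0 : 0 < t := by linarith
    have := norm_nonneg (LinearizedNS.moment v₀)
    have := abs_nonneg (∫ x, ρ₀ x)
    gcongr
    linarith
  · have hev := h.eventually_norm_sq_ge hn1 hα hβ hγ hρ.1
      (fun j => (hv j).1.congr (LinearizedNS.coeFn_component j v₀).symm) hQ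
    obtain ⟨T, hT⟩ := Filter.eventually_atTop.1 hev
    refine ⟨max T 1, by positivity, fun t ht => ?_⟩
    have ht0 : 0 < t := one_pos.trans_le ((le_max_right _ _).trans ht)
    have hge := hT t ((le_max_left _ _).trans ht)
    rw [← hD] at hge
    have hP : ‖LinearizedNS.moment v₀‖ ≤ |∫ x, ρ₀ x| := by
      rw [div_lt_iff₀ (abs_pos.2 hQ)] at hPQ
      have := abs_nonneg (∫ x, ρ₀ x)
      linarith
    calc √D / 2 * (‖LinearizedNS.moment v₀‖ + |∫ x, ρ₀ x|) * t ^ (-(n : ℝ) / 4)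
        ≤ √D / 2 * (|∫ x, ρ₀ x| + |∫ x, ρ₀ x|) * t ^ (-(n : ℝ) / 4) := by gcongr
      _ = √D * |∫ x, ρ₀ x| * t ^ (-(n : ℝ) / 4) := by ring
      _ ≤ ‖v t‖ := by
        refine abs_le_of_sq_le_sq' (le_trans (le_of_eq ?_) hge) (norm_nonneg _) |>.2
        rw [mul_pow, mul_pow, Real.sq_sqrt hD0.le, sq_abs, ← Real.rpow_natCast (t ^ _),
          ← Real.rpow_mul ht0.le]
        congr 2
        push_cast
        ring
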